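/- Let $C$ and $E$ be complete nonsingular (irreducible) algebraic curves over $\mathbb{C}$, where $C$ has genus $2$ and $E$ is an elliptic curve (that is, $E$ has genus $1$), and let $f\colon C\to E$ be a morphism of degree $2$ over $\mathbb{C}$. Then there are $t,t'\in\mathbb{C}\setminus\{0,1\}$ with $t\neq t'$ such that, in suitable affine coordinates $(\xi,y)$ on $C$ and $(x,y)$ on $E$, the curves $C$ and $E$ and the map $f$ are $$C:\ y^2=(t'-\xi^2)(t'-1-\xi^2)(t'-t-\xi^2),\qquad E:\ y^2=x(x-1)(x-t),\qquad f(\xi,y)=(t'-\xi^2,\,y).$$ Precisely: let $C_0$ and $E_0$ be the affine plane curves over $\mathbb{C}$ given by these two equations, and let $f_0\colon C_0\to E_0$, $(\xi,y)\mapsto(t'-\xi^2,y)$. Then there are open immersions $i\colon C_0\hookrightarrow C$ and $j\colon E_0\hookrightarrow E$ over $\mathbb{C}$ with $f\circ i=j\circ f_0$. -/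

import Mathlib

open CategoryTheory AlgebraicGeometry
open scoped Polynomial

noncomputable section

/-- A complete nonsingular algebraic curve over `ℂ`: an integral scheme, proper over `Spec ℂ`,
all of whose local rings at closed points are discrete valuation rings (that is, regular local
rings of dimension one). -/
structure NonsingularCurve where
  /-- the underlying scheme -/
  X : Scheme.{0}
  /-- the structure morphism -/
  π : X ⟶ Spec (.of ℂ)
  isIntegral : IsIntegral X
  isProper : IsProper π
  isDVR : ∀ P : closedPoints X, IsDiscreteValuationRing (X.presheaf.stalk P.1)

namespace NonsingularCurve

attribute [instance] isIntegral isProper isDVR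

variable (C : NonsingularCurve)

/-- The field of rational functions on `C`. -/
abbrev FunctionField : Type := C.X.functionField

/-- The constant functions, as elements of the local ring at `x`. -/
def const (x : C.X) : ℂ →+* C.X.presheaf.stalk x :=
  ((Scheme.ΓSpecIso (.of ℂ)).inv ≫ C.π.appTop ≫ C.X.presheaf.germ ⊤ x trivial).hom

instance : Algebra ℂ C.FunctionField := (C.const (genericPoint C.X)).toAlgebra

theorem algebraMap_const (x : C.X) (c : ℂ) :
    algebraMap (C.X.presheaf.stalk x) C.FunctionField (C.const x c) =
      algebraMap ℂ C.FunctionField c := by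
  have : Nonempty (⊤ : C.X.Opens) := ⟨⟨x, trivial⟩⟩
  exact Scheme.algebraMap_germ_eq_germToFunctionField C.X (U := ⊤) (x := x) trivial _

/-- The valuation `v_P` of the function field given by the order of vanishing at the closed point
`P`, written multiplicatively: `v_P f = exp (-ord_P f)`, and `v_P 0 = 0`. -/
def valuation (P : closedPoints C.X) :
    Valuation C.FunctionField (WithZero (Multiplicative ℤ)) :=
  (IsDiscreteValuationRing.maximalIdeal (C.X.presheaf.stalk P.1)).valuation C.FunctionField

theorem valuation_const_le_one (P : closedPoints C.X) (c : ℂ) :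
    C.valuation P (algebraMap ℂ C.FunctionField c) ≤ 1 := by
  rw [← C.algebraMap_const P.1 c]
  exact IsDedekindDomain.HeightOneSpectrum.valuation_le_one _ _

/-- Divisors: finite formal sums of closed points with integer coefficients. -/
abbrev Divisor : Type := closedPoints C.X →₀ ℤ

variable {C} in
/-- The degree of a divisor (every closed point has residue field `ℂ`, hence degree one). -/
def Divisor.degree (D : C.Divisor) : ℤ := D.sum fun _ n => n

variable {C} in
/-- The Riemann-Roch space `L(D)`: all rational functions `f` with `f = 0` or `div f + D ≥ 0`,
that is, with `ord_P f ≥ -D(P)` at every closed point `P`. -/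
def Divisor.riemannRochSpace (D : C.Divisor) : Submodule ℂ C.FunctionField where
  carrier := {f | ∀ P, C.valuation P f ≤ WithZero.exp (D P)}
  add_mem' hf hg P := (C.valuation P).map_add_le (hf P) (hg P)
  zero_mem' P := by simp
  smul_mem' c f hf P := by
    rw [Algebra.smul_def, map_mul]
    exact (mul_le_of_le_one_left' (C.valuation_const_le_one P c)).trans (hf P)

variable {C} in
/-- `ℓ(D) = dim_ℂ L(D)`. -/
def Divisor.ell (D : C.Divisor) : ℕ := Module.finrank ℂ D.riemannRochSpace

/-- `C` has genus `g`: the genus is the maximum of `deg D + 1 - ℓ(D)` over all divisors `D`. -/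
def HasGenus (g : ℕ) : Prop :=
  IsGreatest (Set.range fun D : C.Divisor => D.degree + 1 - (D.ell : ℤ)) (g : ℤ)

variable {C} in
/-- The morphism `f` is dominant and has degree `n`. As `f` maps the generic point of `C` to the
generic point `η` of `E`, its stalk map there is the inclusion of function fields
`ℂ(E) → ℂ(C)`, and the degree of `f` is the degree of this field extension. -/
def HasDegree {E : NonsingularCurve} (f : C.X ⟶ E.X) (n : ℕ) : Prop :=
  IsDominant f ∧
    letI : Algebra (E.X.presheaf.stalk (f (genericPoint C.X))) C.FunctionField :=
      (f.stalkMap (genericPoint C.X)).hom.toAlgebra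
    Module.finrank (E.X.presheaf.stalk (f (genericPoint C.X))) C.FunctionField = n

end NonsingularCurve

/-- The coordinate ring `ℂ[u, y] / (y² - F(u))` of the affine plane curve `y² = F(u)`. -/
abbrev DoubleCoverRing (F : ℂ[X]) : Type :=
  AdjoinRoot (Polynomial.X ^ 2 - Polynomial.C F : ℂ[X][X])

namespace DoubleCoverRing

variable (F : ℂ[X])

/-- The coordinate function `u` on `y² = F(u)`. -/
def u : DoubleCoverRing F := AdjoinRoot.of _ Polynomial.X

/-- The coordinate function `y` on `y² = F(u)`. -/
def y : DoubleCoverRing F := AdjoinRoot.root _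

/-- The affine plane curve `y² = F(u)` as a scheme. -/
abbrev curve : Scheme.{0} := Spec (.of (DoubleCoverRing F))

/-- The structure morphism of the affine plane curve `y² = F(u)` over `ℂ`. -/
abbrev toSpec : curve F ⟶ Spec (.of ℂ) :=
  Spec.map (CommRingCat.ofHom (algebraMap ℂ (DoubleCoverRing F)))

theorem aeval_u (p : ℂ[X]) : Polynomial.aeval (u F) p = AdjoinRoot.of _ p := by
  have h : (Polynomial.aeval (u F) : ℂ[X] →ₐ[ℂ] DoubleCoverRing F) =
      Algebra.algHom ℂ ℂ[X] (DoubleCoverRing F) := by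
    ext
    simp only [Polynomial.aeval_X]
    rfl
  exact congrArg (fun g => g p) h

theorem y_sq : y F ^ 2 = Polynomial.aeval (u F) F := by
  have h := AdjoinRoot.eval₂_root (Polynomial.X ^ 2 - Polynomial.C F : ℂ[X][X])
  rw [Polynomial.eval₂_sub, Polynomial.eval₂_pow, Polynomial.eval₂_X, Polynomial.eval₂_C,
    sub_eq_zero] at h
  rw [aeval_u]
  exact h

end DoubleCoverRing

/-- The right-hand side `x (x - 1) (x - t)` of the Legendre equation. -/
def legendreCubic (t : ℂ) : ℂ[X] :=
  Polynomial.X * (Polynomial.X - 1) * (Polynomial.X - Polynomial.C t)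

/-- The polynomial `(t' - ξ²) (t' - 1 - ξ²) (t' - t - ξ²)` in `ξ`. -/
def biellipticSextic (t t' : ℂ) : ℂ[X] :=
  (Polynomial.C t' - Polynomial.X ^ 2) * (Polynomial.C t' - 1 - Polynomial.X ^ 2) *
    (Polynomial.C t' - Polynomial.C t - Polynomial.X ^ 2)

theorem aeval_biellipticSextic {R : Type} [CommRing R] [Algebra ℂ R] (t t' : ℂ) (ξ : R) :
    Polynomial.aeval ξ (biellipticSextic t t') =
      Polynomial.aeval (algebraMap ℂ R t' - ξ ^ 2) (legendreCubic t) := by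
  simp only [legendreCubic, biellipticSextic, map_mul, map_sub, map_pow, map_one,
    Polynomial.aeval_X, Polynomial.aeval_C]
  ring

/-- The homomorphism of coordinate rings `x ↦ t' - ξ²`, `y ↦ y` from the Legendre curve
`y² = x (x - 1) (x - t)` to `y² = (t' - ξ²) (t' - 1 - ξ²) (t' - t - ξ²)`. -/
def biellipticCoverRingHom (t t' : ℂ) :
    DoubleCoverRing (legendreCubic t) →+* DoubleCoverRing (biellipticSextic t t') :=
  AdjoinRoot.lift
    (Polynomial.aeval (algebraMap ℂ (DoubleCoverRing (biellipticSextic t t')) t' -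
      DoubleCoverRing.u (biellipticSextic t t') ^ 2)).toRingHom
    (DoubleCoverRing.y (biellipticSextic t t')) (by
      rw [Polynomial.eval₂_sub, Polynomial.eval₂_pow, Polynomial.eval₂_X, Polynomial.eval₂_C,
        DoubleCoverRing.y_sq, aeval_biellipticSextic]
      exact sub_self _)

theorem biellipticCoverRingHom_u (t t' : ℂ) :
    biellipticCoverRingHom t t' (DoubleCoverRing.u _) =
      algebraMap ℂ _ t' - DoubleCoverRing.u _ ^ 2 := by
  simp [biellipticCoverRingHom, DoubleCoverRing.u]

theorem biellipticCoverRingHom_y (t t' : ℂ) :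
    biellipticCoverRingHom t t' (DoubleCoverRing.y _) = DoubleCoverRing.y _ := by
  simp [biellipticCoverRingHom, DoubleCoverRing.y]

/-- The morphism of affine plane curves `(ξ, y) ↦ (x, y) = (t' - ξ², y)`. -/
def biellipticCover (t t' : ℂ) :
    DoubleCoverRing.curve (biellipticSextic t t') ⟶ DoubleCoverRing.curve (legendreCubic t) :=
  Spec.map (CommRingCat.ofHom (biellipticCoverRingHom t t'))

end

/-!
The proof works in the function fields, with closed points seen as valuations.

*Genus.* With the genus `g` as the maximum of `deg D + 1 - ℓ(D)`, principal divisors have degree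
zero (`degree_div`), and `ℓ(D) = deg D + 1 - g` for `D` of large degree (`exists_forall_ell_eq`).
In genus one this holds as soon as `deg D ≥ 1` (`ell_eq_degree`).

*The double cover.* The field `ℂ(C)` is generated over `ℂ(E)` by a square root `δ` of some `d`.
The valuative criterion makes the conjugation `δ ↦ -δ` act on the closed points of `C`, and so
`a + b δ` is regular over a point of `E` iff `a` and `b² d` are regular there
(`forall_valuation_le_one_iff`). For a point `P₀` of `E` this gives
`L(n f^*P₀) = L(n P₀) ⊕ δ L(n P₀ + ⌊div d / 2⌋)`, and a comparison of dimensions for large `n`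
shows `deg ⌊div d / 2⌋ = -1` (`degree_halfDiv`). A divisor of degree one on `E` is linearly
equivalent to a point. Hence `d` can be changed by a square so that it has a double pole at one
point `O` and only simple zeros (`exists_normalized_mul_sq`).

*Equations.* Here `d` itself serves as the coordinate of a Weierstrass equation of `E` with `O` at
infinity. The cubic in it has distinct nonzero roots, since a double root would give a function
with a single simple pole, and a root `0` would make the order of `y²` odd at a simple zero of `d`.
An affine substitution brings the cubic to Legendre form and `d` to a multiple of `t' - x`, by a
constant which is a square (`exists_legendre`). So `ℂ(C) = ℂ(E)(ξ)` with `ξ² = t' - x`.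

*Affine models.* An open subset which misses a closed point is affine
(`isAffineOpen_of_notMem`). The ring of functions on `E` regular away from `O` is `ℂ[x, y]`,
because the pole orders of `xⁱ` and `xⁱ y` are all natural numbers other than `1`
(`exists_eq_aeval_add`), and the ring of functions on `C` regular away from the points over `O` is
`ℂ[x, y][ξ]`, because `t' - x` has only simple zeros (`exists_bielliptic_ringEquiv`). These two
rings are the coordinate rings of the affine plane curves, which gives the open immersions.
-/

noncomputable section

/-! ### Points, local rings and the function field -/

namespace NonsingularCurve

open IsLocalRing

variable (C : NonsingularCurve)

/-- The local ring at the generic point is a field, hence not a discrete valuation ring. -/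
theorem genericPoint_notMem_closedPoints : genericPoint C.X ∉ closedPoints C.X := by
  intro h
  have := C.isDVR ⟨_, h⟩
  exact IsDiscreteValuationRing.not_isField (C.X.presheaf.stalk (genericPoint C.X))
    (Field.toIsField C.X.functionField)

instance : IsNoetherian C.X :=
  { toIsLocallyNoetherian := LocallyOfFiniteType.isLocallyNoetherian C.π
    toCompactSpace := (quasiCompact_iff_compactSpace C.π).mp inferInstance }

theorem exists_closedPoint_mem {S : Set C.X} (hS : IsClosed S) (hne : S.Nonempty) :
    ∃ P : closedPoints C.X, P.1 ∈ S := by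
  obtain ⟨x, hx, hx'⟩ := hS.exists_closed_singleton hne
  exact ⟨⟨x, hx'⟩, hx⟩

/-- A point specializes to a closed point, whose local ring has only two prime ideals. -/
theorem eq_genericPoint_or_mem_closedPoints (x : C.X) :
    x = genericPoint C.X ∨ x ∈ closedPoints C.X := by
  obtain ⟨P, hP⟩ := C.exists_closedPoint_mem (S := closure {x}) isClosed_closure
    ⟨x, subset_closure rfl⟩
  have hxP : x ⤳ P.1 := specializes_iff_mem_closure.mpr hP
  have hηP : genericPoint C.X ⤳ P.1 := genericPoint_specializes _
  have key : ∀ y : C.X, y ⤳ P.1 →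
      y = P.1 ∨ y = C.X.fromSpecStalk P.1 (⊥ : PrimeSpectrum (C.X.presheaf.stalk P.1)) := by
    intro y hy
    rw [← Set.mem_ofPred_eq (p := fun y => y ⤳ P.1), ← Scheme.range_fromSpecStalk] at hy
    obtain ⟨p, rfl⟩ := hy
    by_cases hp : p.asIdeal = ⊥
    · right
      congr 1
      exact PrimeSpectrum.ext hp
    · left
      have hp' : p.asIdeal = maximalIdeal (C.X.presheaf.stalk P.1) :=
        eq_maximalIdeal (p.2.isMaximal hp)
      have : p = closedPoint (C.X.presheaf.stalk P.1) := PrimeSpectrum.ext hp'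
      rw [this, Scheme.fromSpecStalk_closedPoint]
  rcases key x hxP with h | h
  · exact Or.inr (h ▸ P.2)
  · rcases key _ hηP with h' | h'
    · exact absurd (h' ▸ P.2) C.genericPoint_notMem_closedPoints
    · exact Or.inl (h.trans h'.symm)

/-- The complement of a nonempty open set is a finite union of irreducible closed sets, each the
closure of a point other than the generic one. -/
theorem finite_closedPoints_notMem (U : C.X.Opens) (hU : (U : Set C.X).Nonempty) :
    {P : closedPoints C.X | P.1 ∉ U}.Finite := by
  obtain ⟨S, hS, hc, hi, hs⟩ :=
    TopologicalSpace.NoetherianSpace.exists_finite_set_isClosed_irreducible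
    (s := (U : Set C.X)ᶜ) U.isOpen.isClosed_compl
  have hη : genericPoint C.X ∈ U :=
    ((genericPoint_spec C.X).mem_open_set_iff U.isOpen).mpr (by simpa using hU)
  suffices h : ∀ t ∈ S, {P : closedPoints C.X | P.1 ∈ t}.Finite by
    refine (hS.biUnion h).subset fun P hP => ?_
    have : P.1 ∈ (U : Set C.X)ᶜ := hP
    rw [hs] at this
    simpa using this
  intro t ht
  obtain ⟨z, hz⟩ := QuasiSober.sober (hi t ht) (hc t ht)
  have hzt : z ∈ t := hz.mem
  have hzU : z ∉ U := by
    have : z ∈ (U : Set C.X)ᶜ := hs ▸ ⟨t, ht, hzt⟩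
    exact this
  have hzc : z ∈ closedPoints C.X :=
    (C.eq_genericPoint_or_mem_closedPoints z).resolve_left fun h => hzU (h ▸ hη)
  have htz : t = {z} := by rw [← hz.def, hzc.closure_eq]
  refine (Set.finite_singleton (⟨z, hzc⟩ : closedPoints C.X)).subset fun P hP => ?_
  have : P.1 ∈ t := hP
  rw [htz] at this
  exact Subtype.ext this

/-- The map `const` describes the structure morphism on `Spec` of the local ring at `x`. -/
theorem specMap_const (x : C.X) :
    Spec.map (CommRingCat.ofHom (C.const x)) = C.X.fromSpecStalk x ≫ C.π := by
  apply ext_of_isAffine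
  rw [Scheme.Hom.comp_appTop, Scheme.fromSpecStalk_appTop]
  have h : CommRingCat.ofHom (C.const x) = (Scheme.ΓSpecIso (.of ℂ)).inv ≫ C.π.appTop ≫
    C.X.presheaf.germ ⊤ x trivial := rfl
  have h2 := Scheme.ΓSpecIso_naturality (CommRingCat.ofHom (C.const x))
  rw [← Iso.eq_comp_inv] at h2
  rw [h2, h]
  simp

variable {C}

/-- `f` lies in the local ring at `P` iff `v_P f ≤ 1`. -/
theorem valuation_le_one_iff {P : closedPoints C.X} {f : C.FunctionField} :
    C.valuation P f ≤ 1 ↔ ∃ a, algebraMap (C.X.presheaf.stalk P.1) C.FunctionField a = f := by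
  constructor
  · intro h
    obtain ⟨n, d, hnd⟩ :=
      IsDedekindDomain.HeightOneSpectrum.exists_primeCompl_mul_eq_of_integer _ f h
    have hd : IsUnit (d : C.X.presheaf.stalk P.1) := by
      by_contra hd
      exact d.2 ((mem_maximalIdeal _).mpr hd)
    obtain ⟨u, hu⟩ := hd
    refine ⟨n * ↑u⁻¹, ?_⟩
    rw [map_mul, ← hnd, ← hu, mul_assoc, ← map_mul, Units.mul_inv, map_one, mul_one]
  · rintro ⟨a, rfl⟩
    exact IsDedekindDomain.HeightOneSpectrum.valuation_le_one _ _

theorem valuation_algebraMap_lt_one_iff {P : closedPoints C.X} {a : C.X.presheaf.stalk P.1} :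
    C.valuation P (algebraMap _ _ a) < 1 ↔ a ∈ maximalIdeal (C.X.presheaf.stalk P.1) :=
  IsDedekindDomain.HeightOneSpectrum.valuation_lt_one_iff_mem _ _

/-- The residue field at a closed point is `ℂ`. -/
theorem exists_const_sub_mem_maximalIdeal (P : closedPoints C.X) (a : C.X.presheaf.stalk P.1) :
    ∃ c : ℂ, a - C.const P.1 c ∈ maximalIdeal (C.X.presheaf.stalk P.1) := by
  let e := residueFieldIsoBase C.π P.1 P.2
  let r := (C.X.residue P.1).hom
  have h1 : ∀ c : ℂ, r (C.const P.1 c) = e.inv.hom c := by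
    intro c
    have h : CommRingCat.ofHom (C.const P.1) ≫ C.X.residue P.1 = e.inv := by
      apply Spec.map_injective
      rw [Spec.map_comp, specMap_const]
      exact (SpecMap_residueFieldIsoBase_inv C.π P.1 P.2).symm
    exact ConcreteCategory.congr_hom h c
  refine ⟨e.hom.hom (r a), ?_⟩
  have h2 : r (a - C.const P.1 (e.hom.hom (r a))) = 0 := by
    rw [map_sub, h1, sub_eq_zero]
    exact (ConcreteCategory.congr_hom e.hom_inv_id (r a)).symm
  exact (IsLocalRing.residue_eq_zero_iff _).mp h2

/-- A function regular at `P` has a value at `P`. -/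
theorem exists_valuation_sub_const_lt_one {P : closedPoints C.X} {f : C.FunctionField}
    (hf : C.valuation P f ≤ 1) : ∃ c : ℂ, C.valuation P (f - algebraMap ℂ _ c) < 1 := by
  obtain ⟨a, rfl⟩ := valuation_le_one_iff.mp hf
  obtain ⟨c, hc⟩ := exists_const_sub_mem_maximalIdeal P a
  refine ⟨c, ?_⟩
  rw [← C.algebraMap_const P.1 c, ← map_sub]
  exact valuation_algebraMap_lt_one_iff.mpr hc

theorem valuation_le_one_of_mem {U : C.X.Opens} [Nonempty U] (s : Γ(C.X, U)) {P : closedPoints C.X}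
    (hP : P.1 ∈ U) : C.valuation P (C.X.germToFunctionField U s) ≤ 1 := by
  rw [← Scheme.algebraMap_germ_eq_germToFunctionField C.X (x := P.1) hP]
  exact IsDedekindDomain.HeightOneSpectrum.valuation_le_one _ _

theorem finite_valuation_ne_one {f : C.FunctionField} (hf : f ≠ 0) :
    {P : closedPoints C.X | C.valuation P f ≠ 1}.Finite := by
  obtain ⟨U, -, s, hU, rfl, hs⟩ := exists_isUnit_germ_eq (X := C.X) f hf
  refine (C.finite_closedPoints_notMem U ⟨hU.some.1, hU.some.2⟩).subset fun P hP hPU => hP ?_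
  obtain ⟨u, rfl⟩ := hs
  refine le_antisymm (valuation_le_one_of_mem _ hPU) ?_
  have h := valuation_le_one_of_mem (↑u⁻¹ : Γ(C.X, U)) hPU
  have h1 : C.valuation P (C.X.germToFunctionField U ↑u) *
      C.valuation P (C.X.germToFunctionField U ↑u⁻¹) = 1 := by
    rw [← map_mul, ← map_mul, Units.mul_inv, map_one, map_one]
  rw [← h1]
  exact mul_le_of_le_one_right' h

theorem algebraMap_stalk_surjective_of_eq_genericPoint {x : C.X} (h : x = genericPoint C.X) :
    Function.Surjective (algebraMap (C.X.presheaf.stalk x) C.FunctionField) := by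
  subst h
  refine fun f => ⟨f, ?_⟩
  change C.X.presheaf.stalkSpecializes (specializes_refl _) f = f
  rw [TopCat.Presheaf.stalkSpecializes_refl]
  rfl

/-- A rational function which is regular at all closed points of an open set is a section. -/
theorem exists_section_of_valuation_le_one (U : C.X.Opens) [hU : Nonempty U] {f : C.FunctionField}
    (hf : ∀ P : closedPoints C.X, P.1 ∈ U → C.valuation P f ≤ 1) :
    ∃ s : Γ(C.X, U), C.X.germToFunctionField U s = f := by
  have h1 : ∀ x : U, ∃ (V : C.X.Opens) (hV : V ≤ U) (_ : Nonempty V) (_ : x.1 ∈ V) (s : Γ(C.X, V)),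
      C.X.germToFunctionField V s = f := by
    intro x
    obtain ⟨a, ha⟩ : ∃ a, algebraMap (C.X.presheaf.stalk x.1) C.FunctionField a = f := by
      rcases C.eq_genericPoint_or_mem_closedPoints x.1 with h | h
      · exact algebraMap_stalk_surjective_of_eq_genericPoint h f
      · exact valuation_le_one_iff.mp (hf ⟨x.1, h⟩ x.2)
    obtain ⟨V, hxV, s, hs⟩ := C.X.presheaf.exists_germ_eq a
    have : Nonempty (V ⊓ U : C.X.Opens) := ⟨⟨x.1, hxV, x.2⟩⟩
    refine ⟨V ⊓ U, inf_le_right, this, ⟨hxV, x.2⟩,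
      C.X.presheaf.map (homOfLE (inf_le_left : V ⊓ U ≤ V)).op s, ?_⟩
    rw [← Scheme.algebraMap_germ_eq_germToFunctionField C.X (x := x.1)
      (show x.1 ∈ V ⊓ U from ⟨hxV, x.2⟩), ← ha, ← hs]
    congr 1
    exact C.X.presheaf.germ_res_apply _ _ _ _
  choose V hV hne hmem s hs using h1
  obtain ⟨t, ht, -⟩ := C.X.sheaf.existsUnique_gluing' V U (fun x => homOfLE (hV x))
    (fun x hx => TopologicalSpace.Opens.mem_iSup.mpr ⟨⟨x, hx⟩, hmem _⟩) s (by
      intro x y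
      have hη : ∀ x, genericPoint C.X ∈ V x := fun x =>
        ((genericPoint_spec C.X).mem_open_set_iff (V x).isOpen).mpr (by simpa using hne x)
      have : Nonempty (V x ⊓ V y : C.X.Opens) := ⟨⟨_, hη x, hη y⟩⟩
      apply C.X.germToFunctionField_injective (V x ⊓ V y)
      refine (C.X.presheaf.germ_res_apply _ _ _ _).trans (((hs x).trans (hs y).symm).trans
        (C.X.presheaf.germ_res_apply _ _ _ _).symm))
  refine ⟨t, ?_⟩
  rw [← hs hU.some, ← ht hU.some]
  exact (C.X.presheaf.germ_res_apply _ _ _ _).symm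

/-- The valuative criterion: a proper valuation ring of the function field that contains the
constants is the local ring at a closed point. -/
theorem exists_valuation_le_one_iff_mem (R : ValuationSubring C.FunctionField)
    (hR : ∀ c : ℂ, algebraMap ℂ C.FunctionField c ∈ R) (hne : R ≠ ⊤) :
    ∃ P : closedPoints C.X, ∀ f, C.valuation P f ≤ 1 ↔ f ∈ R := by
  let i₂ : Spec (.of R) ⟶ Spec (.of ℂ) :=
    Spec.map (CommRingCat.ofHom ((algebraMap ℂ C.FunctionField).codRestrict R.toSubring hR))
  have w : C.X.fromSpecStalk (genericPoint C.X) ≫ C.π =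
      Spec.map (CommRingCat.ofHom (algebraMap R C.FunctionField)) ≫ i₂ := by
    rw [← specMap_const, ← Spec.map_comp]
    rfl
  have hv : ValuativeCriterion C.π := by
    have := C.isProper
    rw [IsProper.eq_valuativeCriterion] at this
    exact this.1.1.1
  obtain ⟨l, hl₁, -⟩ := (hv.existence
    { R := R, K := C.FunctionField, i₁ := C.X.fromSpecStalk (genericPoint C.X), i₂ := i₂,
      commSq := ⟨w⟩ }).exists_lift
  -- the centre of `R` on the curve
  let x : C.X := l (closedPoint R)
  let ψ : C.X.presheaf.stalk x ⟶ .of R := Scheme.stalkClosedPointTo l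
  have hψ : ∀ a, ((ψ a : R) : C.FunctionField) = algebraMap _ C.FunctionField a := by
    have hx : genericPoint C.X ⤳ x := genericPoint_specializes _
    have : ψ ≫ CommRingCat.ofHom (algebraMap R C.FunctionField) =
        C.X.presheaf.stalkSpecializes hx := by
      apply Spec.map_injective
      rw [← cancel_mono (C.X.fromSpecStalk x), Scheme.SpecMap_stalkSpecializes_fromSpecStalk,
        Spec.map_comp, Category.assoc, Scheme.Spec_stalkClosedPointTo_fromSpecStalk]
      exact hl₁
    exact fun a => ConcreteCategory.congr_hom this a
  rcases C.eq_genericPoint_or_mem_closedPoints x with h | h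
  · refine absurd (top_le_iff.mp fun f _ => ?_) hne
    obtain ⟨a, rfl⟩ := algebraMap_stalk_surjective_of_eq_genericPoint h f
    exact hψ a ▸ (ψ a : R).2
  · have := C.isDVR ⟨x, h⟩
    refine ⟨⟨x, h⟩, fun f => ?_⟩
    have hle : (C.valuation ⟨x, h⟩).valuationSubring ≤ R := by
      intro f hf
      obtain ⟨a, rfl⟩ := valuation_le_one_iff.mp ((Valuation.mem_valuationSubring_iff _ _).mp hf)
      exact hψ a ▸ (ψ a : R).2
    rw [valuation, ← IsDedekindDomain.HeightOneSpectrum.valuationSubringAtPrime_eq_valuationSubring]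
      at hle
    -- a discrete valuation ring is a maximal proper subring of its fraction field
    have := ValuationSubring.eq_of_le_of_ne_top _ hle hne
    rw [← this, IsDedekindDomain.HeightOneSpectrum.valuationSubringAtPrime_eq_valuationSubring]
    rfl

end NonsingularCurve

/-! ### Orders of vanishing -/

namespace NonsingularCurve

open IsLocalRing

variable {C : NonsingularCurve}

instance : CharZero C.FunctionField :=
  charZero_of_injective_algebraMap (algebraMap ℂ C.FunctionField).injective

/-- The order of vanishing of a rational function at a closed point, with the convention
`ord P 0 = 0`. -/
def ord (P : closedPoints C.X) (f : C.FunctionField) : ℤ := -(C.valuation P f).log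

theorem valuation_eq_exp {P : closedPoints C.X} {f : C.FunctionField} (hf : f ≠ 0) :
    C.valuation P f = WithZero.exp (-ord P f) := by
  rw [ord, neg_neg, WithZero.exp_log ((Valuation.ne_zero_iff _).mpr hf)]

theorem valuation_le_exp_iff {P : closedPoints C.X} {f : C.FunctionField} (hf : f ≠ 0) {n : ℤ} :
    C.valuation P f ≤ WithZero.exp n ↔ -n ≤ ord P f := by
  rw [valuation_eq_exp hf, WithZero.exp_le_exp, neg_le]

theorem valuation_le_one_iff_ord {P : closedPoints C.X} {f : C.FunctionField} (hf : f ≠ 0) :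
    C.valuation P f ≤ 1 ↔ 0 ≤ ord P f := by
  rw [← WithZero.exp_zero, valuation_le_exp_iff hf, neg_zero]

theorem valuation_lt_one_iff_ord {P : closedPoints C.X} {f : C.FunctionField} (hf : f ≠ 0) :
    C.valuation P f < 1 ↔ 0 < ord P f := by
  rw [← WithZero.exp_zero, valuation_eq_exp hf, WithZero.exp_lt_exp, neg_lt_zero]

theorem valuation_eq_one_iff_ord {P : closedPoints C.X} {f : C.FunctionField} (hf : f ≠ 0) :
    C.valuation P f = 1 ↔ ord P f = 0 := by
  rw [← WithZero.exp_zero, valuation_eq_exp hf, WithZero.exp_inj, neg_eq_zero]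

theorem ord_mul {P : closedPoints C.X} {f g : C.FunctionField} (hf : f ≠ 0) (hg : g ≠ 0) :
    ord P (f * g) = ord P f + ord P g := by
  rw [ord, map_mul, WithZero.log_mul ((Valuation.ne_zero_iff _).mpr hf)
    ((Valuation.ne_zero_iff _).mpr hg), neg_add]
  rfl

theorem ord_inv (P : closedPoints C.X) (f : C.FunctionField) : ord P f⁻¹ = -ord P f := by
  rw [ord, map_inv₀, WithZero.log_inv]
  rfl

theorem ord_pow (P : closedPoints C.X) (f : C.FunctionField) (n : ℕ) :
    ord P (f ^ n) = n * ord P f := by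
  rw [ord, map_pow, WithZero.log_pow, ord, nsmul_eq_mul, mul_neg]

theorem ord_zpow (P : closedPoints C.X) (f : C.FunctionField) (n : ℤ) :
    ord P (f ^ n) = n * ord P f := by
  rw [ord, map_zpow₀, WithZero.log_zpow, ord, smul_eq_mul, mul_neg]

theorem ord_one (P : closedPoints C.X) : ord P (1 : C.FunctionField) = 0 := by
  rw [ord, map_one, WithZero.log_one, neg_zero]

theorem ord_neg (P : closedPoints C.X) (f : C.FunctionField) : ord P (-f) = ord P f := by
  rw [ord, Valuation.map_neg, ord]

theorem ord_algebraMap (P : closedPoints C.X) (c : ℂ) :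
    ord P (algebraMap ℂ C.FunctionField c) = 0 := by
  rcases eq_or_ne c 0 with rfl | hc
  · rw [map_zero, ord, map_zero, WithZero.log_zero, neg_zero]
  · have hc' : algebraMap ℂ C.FunctionField c ≠ 0 := (map_ne_zero _).mpr hc
    have h := (valuation_le_one_iff_ord hc').mp (C.valuation_const_le_one P c)
    have h' : 0 ≤ ord P (algebraMap ℂ C.FunctionField c⁻¹) :=
      (valuation_le_one_iff_ord ((map_ne_zero _).mpr (inv_ne_zero hc))).mp
        (C.valuation_const_le_one P _)
    rw [map_inv₀, ord_inv] at h'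
    omega

theorem ord_add_eq_of_lt {P : closedPoints C.X} {f g : C.FunctionField} (hf : f ≠ 0)
    (hg : g ≠ 0 → ord P f < ord P g) : f + g ≠ 0 ∧ ord P (f + g) = ord P f := by
  have h : C.valuation P g < C.valuation P f := by
    rcases eq_or_ne g 0 with rfl | h0
    · rw [map_zero]
      exact zero_lt_iff.mpr ((Valuation.ne_zero_iff _).mpr hf)
    · rw [valuation_eq_exp h0, valuation_eq_exp hf, WithZero.exp_lt_exp, neg_lt_neg_iff]
      exact hg h0
  have h2 := Valuation.map_add_eq_of_lt_left _ h
  constructor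
  · intro h0
    rw [h0, map_zero] at h2
    exact (Valuation.ne_zero_iff _).mpr hf h2.symm
  · rw [ord, h2, ord]

theorem exists_ord_eq_one (P : closedPoints C.X) : ∃ f : C.FunctionField, f ≠ 0 ∧ ord P f = 1 := by
  obtain ⟨π, hπ⟩ := IsDedekindDomain.HeightOneSpectrum.valuation_exists_uniformizer C.FunctionField
    (IsDiscreteValuationRing.maximalIdeal (C.X.presheaf.stalk P.1))
  have h : C.valuation P π = WithZero.exp (-1) := hπ
  have h0 : π ≠ 0 := by
    rintro rfl
    rw [map_zero] at h
    exact WithZero.exp_ne_zero h.symm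
  refine ⟨π, h0, ?_⟩
  rw [valuation_eq_exp h0, WithZero.exp_inj] at h
  omega

theorem exists_ord_eq (P : closedPoints C.X) (n : ℤ) :
    ∃ f : C.FunctionField, f ≠ 0 ∧ ord P f = n := by
  obtain ⟨f, hf, h⟩ := exists_ord_eq_one P
  exact ⟨f ^ n, zpow_ne_zero _ hf, by rw [ord_zpow, h, mul_one]⟩

/-- The divisor of a rational function (zero for `f = 0`). -/
def div (f : C.FunctionField) : C.Divisor :=
  Finsupp.ofSupportFinite (fun P => ord P f) (by
    rcases eq_or_ne f 0 with rfl | hf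
    · simp [ord, Function.support]
    · refine (finite_valuation_ne_one hf).subset fun P hP h => hP ?_
      exact (valuation_eq_one_iff_ord hf).mp h)

@[simp] theorem div_apply (f : C.FunctionField) (P : closedPoints C.X) : div f P = ord P f := rfl

theorem mem_riemannRochSpace_iff {D : C.Divisor} {f : C.FunctionField} (hf : f ≠ 0) :
    f ∈ D.riemannRochSpace ↔ ∀ P, -D P ≤ ord P f :=
  forall_congr' fun _ => valuation_le_exp_iff hf

end NonsingularCurve

namespace NonsingularCurve

variable {C : NonsingularCurve}

/-! ### Divisors and Riemann-Roch spaces -/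

namespace Divisor

theorem degree_zero : (0 : C.Divisor).degree = 0 := Finsupp.sum_zero_index

theorem degree_add (D D' : C.Divisor) : (D + D').degree = D.degree + D'.degree :=
  Finsupp.sum_add_index' (fun _ => rfl) (fun _ _ _ => rfl)

theorem degree_neg (D : C.Divisor) : (-D).degree = -D.degree := by
  have := degree_add D (-D)
  rw [add_neg_cancel, degree_zero] at this
  omega

theorem degree_sub (D D' : C.Divisor) : (D - D').degree = D.degree - D'.degree := by
  rw [sub_eq_add_neg, degree_add, degree_neg, sub_eq_add_neg]

theorem degree_single (P : closedPoints C.X) (n : ℤ) :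
    degree (Finsupp.single P n : C.Divisor) = n := Finsupp.sum_single_index rfl

theorem degree_nsmul (n : ℕ) (D : C.Divisor) : (n • D).degree = n * D.degree := by
  induction n with
  | zero => simp [degree_zero]
  | succ n ih => rw [succ_nsmul, degree_add, ih]; push_cast; ring

theorem degree_nonneg {D : C.Divisor} (hD : 0 ≤ D) : 0 ≤ D.degree :=
  Finsupp.sum_nonneg fun P _ => hD P

theorem sub_single_nonneg {F : C.Divisor} (hF : 0 ≤ F) {P : closedPoints C.X} (hP : F P ≠ 0) :
    0 ≤ F - Finsupp.single P 1 := fun Q => by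
  classical
  have h2 := hF Q
  simp only [Finsupp.coe_zero, Pi.zero_apply, Finsupp.sub_apply, Finsupp.single_apply] at *
  split_ifs with h
  · subst h; omega
  · omega

theorem eq_zero_of_degree_eq_zero {F : C.Divisor} (hF : 0 ≤ F) (h : F.degree = 0) : F = 0 := by
  by_contra h0
  obtain ⟨P, hP⟩ := Finsupp.ne_iff.mp h0
  have h2 := degree_nonneg (sub_single_nonneg hF hP)
  rw [degree_sub, degree_single] at h2
  omega

theorem exists_apply_ne_zero {F : C.Divisor} (h : F.degree ≠ 0) : ∃ P, F P ≠ 0 := by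
  by_contra! h'
  exact h (by rw [show F = 0 from Finsupp.ext h', degree_zero])

theorem exists_eq_single {F : C.Divisor} (hF : 0 ≤ F) (h : F.degree = 1) :
    ∃ Q, F = Finsupp.single Q 1 := by
  obtain ⟨Q, hQ⟩ := exists_apply_ne_zero (F := F) (by omega)
  refine ⟨Q, sub_eq_zero.mp (eq_zero_of_degree_eq_zero (sub_single_nonneg hF hQ) ?_)⟩
  rw [degree_sub, degree_single]
  omega

theorem riemannRochSpace_mono {D D' : C.Divisor} (h : D ≤ D') :
    D.riemannRochSpace ≤ D'.riemannRochSpace := fun _ hf P =>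
  (hf P).trans (WithZero.exp_le_exp.mpr (h P))

end Divisor

open Divisor

theorem div_inv (f : C.FunctionField) : div f⁻¹ = -div f := Finsupp.ext fun P => ord_inv P f

theorem div_zpow (f : C.FunctionField) (n : ℤ) : div (f ^ n) = n • div f :=
  Finsupp.ext fun P => by simp [ord_zpow]

theorem mul_mem_riemannRochSpace {D D' : C.Divisor} {f g : C.FunctionField}
    (hf : f ∈ D.riemannRochSpace) (hg : g ∈ D'.riemannRochSpace) :
    f * g ∈ (D + D').riemannRochSpace := fun P => by
  rw [map_mul, Finsupp.add_apply, WithZero.exp_add]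
  exact mul_le_mul' (hf P) (hg P)

theorem mem_riemannRochSpace_neg_div (f : C.FunctionField) :
    f ∈ (-div f : C.Divisor).riemannRochSpace := by
  rcases eq_or_ne f 0 with rfl | hf
  · exact zero_mem _
  · exact (mem_riemannRochSpace_iff hf).mpr fun P => by simp

theorem add_div_nonneg {D : C.Divisor} {h : C.FunctionField} (h0 : h ≠ 0)
    (hh : h ∈ D.riemannRochSpace) : 0 ≤ D + div h := fun P => by
  have := (mem_riemannRochSpace_iff h0).mp hh P
  simp only [Finsupp.coe_zero, Pi.zero_apply, Finsupp.add_apply, div_apply]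
  omega

/-- Linearly equivalent divisors have Riemann-Roch spaces of the same dimension. -/
theorem ell_sub_div (D : C.Divisor) {h : C.FunctionField} (hh : h ≠ 0) :
    (D - div h).ell = D.ell := by
  have hmap : (D - div h).riemannRochSpace =
      D.riemannRochSpace.map (LinearMap.mulLeft ℂ h) := by
    ext f
    rw [Submodule.mem_map]
    constructor
    · intro hf
      refine ⟨h⁻¹ * f, ?_, mul_inv_cancel_left₀ hh f⟩
      have := mul_mem_riemannRochSpace (mem_riemannRochSpace_neg_div h⁻¹) hf
      rwa [div_inv, neg_neg, add_sub_cancel] at this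
    · rintro ⟨g, hg, rfl⟩
      have := mul_mem_riemannRochSpace (mem_riemannRochSpace_neg_div h) hg
      rwa [neg_add_eq_sub] at this
  rw [ell, hmap]
  exact (Submodule.equivMapOfInjective _ (mul_right_injective₀ hh) _).finrank_eq.symm

/-- On a curve of finite genus principal divisors have degree zero: otherwise the multiples of
one would have unbounded degree, although all of them have the same `ℓ`. -/
theorem degree_div {g : ℕ} (hC : C.HasGenus g) {h : C.FunctionField} (hh : h ≠ 0) :
    (div h).degree = 0 := by
  have key : ∀ n : ℤ, (-(n • div h)).degree + 1 - ((0 : C.Divisor).ell : ℤ) ≤ g := by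
    intro n
    have := hC.2 ⟨-(n • div h), rfl⟩
    have h2 := ell_sub_div (0 : C.Divisor) (zpow_ne_zero n hh)
    rw [zero_sub, div_zpow] at h2
    dsimp only at this
    rwa [h2] at this
  have hz : ∀ n : ℤ, (n • div h).degree = n * (div h).degree := by
    intro n
    obtain ⟨m, rfl | rfl⟩ := n.eq_nat_or_neg
    · rw [natCast_zsmul, degree_nsmul]
    · rw [neg_smul, degree_neg, natCast_zsmul, degree_nsmul]; ring
  by_contra hd
  -- for this multiple of `-div h` the degree exceeds the bound of `key`
  have h1 := key (-(div h).degree * (g + (0 : C.Divisor).ell + 1))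
  rw [degree_neg, hz] at h1
  have h2 : 1 ≤ (div h).degree * (div h).degree := by
    have := mul_self_pos.mpr hd
    omega
  have h3 : (0 : ℤ) ≤ g + (0 : C.Divisor).ell + 1 := by positivity
  nlinarith [mul_le_mul_of_nonneg_right h2 h3]

theorem degree_nonneg_of_mem {g : ℕ} (hC : C.HasGenus g) {D : C.Divisor} {f : C.FunctionField}
    (hf : f ≠ 0) (hfD : f ∈ D.riemannRochSpace) : 0 ≤ D.degree := by
  have h := degree_nonneg (add_div_nonneg hf hfD)
  rwa [degree_add, degree_div hC hf, add_zero] at h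

theorem riemannRochSpace_eq_bot {g : ℕ} (hC : C.HasGenus g) {D : C.Divisor} (hD : D.degree < 0) :
    D.riemannRochSpace = ⊥ := by
  rw [Submodule.eq_bot_iff]
  intro f hf
  by_contra h0
  exact absurd (degree_nonneg_of_mem hC h0 hf) (by omega)

theorem mem_riemannRochSpace_sub_single {D : C.Divisor} {P : closedPoints C.X}
    {f : C.FunctionField} (hf : f ∈ D.riemannRochSpace)
    (hP : f ≠ 0 → ord P f ≠ -D P) : f ∈ (D - Finsupp.single P 1).riemannRochSpace := by
  classical
  rcases eq_or_ne f 0 with rfl | h0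
  · exact zero_mem _
  · rw [mem_riemannRochSpace_iff h0] at hf ⊢
    intro Q
    rw [Finsupp.sub_apply, Finsupp.single_apply]
    split_ifs with h
    · subst h
      have := hP h0
      have := hf P
      omega
    · have := hf Q
      omega

/-- If `f` has the exact order `-D(P)` allowed by `D` at `P`, then it spans `L(D)` modulo
`L(D - P)`, because the residue field at `P` is `ℂ`. -/
theorem exists_sub_smul_mem {D : C.Divisor} {P : closedPoints C.X} {f h : C.FunctionField}
    (hf : f ∈ D.riemannRochSpace) (hf0 : f ≠ 0) (hfP : ord P f = -D P)
    (hh : h ∈ D.riemannRochSpace) :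
    ∃ c : ℂ, h - c • f ∈ (D - Finsupp.single P 1).riemannRochSpace := by
  have h1 : C.valuation P (h / f) ≤ 1 := by
    rcases eq_or_ne h 0 with rfl | h0
    · simp
    · rw [valuation_le_one_iff_ord (div_ne_zero h0 hf0), div_eq_mul_inv,
        ord_mul h0 (inv_ne_zero hf0), ord_inv, hfP]
      have := (mem_riemannRochSpace_iff h0).mp hh P
      omega
  obtain ⟨c, hc⟩ := exists_valuation_sub_const_lt_one h1
  refine ⟨c, mem_riemannRochSpace_sub_single (sub_mem hh (Submodule.smul_mem _ c hf)) ?_⟩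
  intro h0
  have h2 : h - c • f = (h / f - algebraMap ℂ _ c) * f := by
    rw [sub_mul, div_mul_cancel₀ _ hf0, Algebra.smul_def]
  have h3 : h / f - algebraMap ℂ _ c ≠ 0 := by
    intro h3
    rw [h2, h3, zero_mul] at h0
    exact h0 rfl
  rw [h2, ord_mul h3 hf0, hfP]
  have := (valuation_lt_one_iff_ord h3).mp hc
  omega

/-- `L(D)` is larger than `L(D - P)` by at most one dimension. -/
theorem riemannRochSpace_le_sup {D : C.Divisor} {P : closedPoints C.X} :
    ∃ f : C.FunctionField,
      D.riemannRochSpace ≤ (D - Finsupp.single P 1).riemannRochSpace ⊔ ℂ ∙ f := by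
  by_cases h : ∃ f ∈ D.riemannRochSpace, f ≠ 0 ∧ ord P f = -D P
  · obtain ⟨f, hf, hf0, hfP⟩ := h
    refine ⟨f, fun h hh => ?_⟩
    obtain ⟨c, hc⟩ := exists_sub_smul_mem hf hf0 hfP hh
    rw [← sub_add_cancel h (c • f)]
    exact Submodule.add_mem_sup hc (Submodule.smul_mem _ c (Submodule.mem_span_singleton_self f))
  · push Not at h
    exact ⟨0, fun f hf => Submodule.mem_sup_left (mem_riemannRochSpace_sub_single hf (h f hf))⟩

theorem finiteDimensional_of_sub_single {D : C.Divisor} (P : closedPoints C.X)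
    [FiniteDimensional ℂ (D - Finsupp.single P 1).riemannRochSpace] :
    FiniteDimensional ℂ D.riemannRochSpace := by
  obtain ⟨f, hf⟩ := riemannRochSpace_le_sup (D := D) (P := P)
  exact Submodule.finiteDimensional_of_le hf

theorem nonempty_closedPoints (C : NonsingularCurve) : Nonempty (closedPoints C.X) := by
  obtain ⟨P, -⟩ := C.exists_closedPoint_mem isClosed_univ ⟨genericPoint C.X, trivial⟩
  exact ⟨P⟩

theorem finiteDimensional_riemannRochSpace {g : ℕ} (hC : C.HasGenus g) (D : C.Divisor) :
    FiniteDimensional ℂ D.riemannRochSpace := by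
  obtain ⟨P⟩ := C.nonempty_closedPoints
  have key : ∀ (n : ℕ) (D : C.Divisor), D.degree < n → FiniteDimensional ℂ D.riemannRochSpace := by
    intro n
    induction n with
    | zero =>
      intro D hD
      rw [riemannRochSpace_eq_bot hC (by exact_mod_cast hD)]
      infer_instance
    | succ n ih =>
      intro D hD
      have := ih (D - Finsupp.single P 1)
        (by rw [degree_sub, degree_single]; push_cast at hD; omega)
      exact finiteDimensional_of_sub_single P
  exact key (D.degree.toNat + 1) D (by omega)

theorem ell_le_ell_sub_single_add_one {g : ℕ} (hC : C.HasGenus g) (D : C.Divisor)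
    (P : closedPoints C.X) : D.ell ≤ (D - Finsupp.single P 1).ell + 1 := by
  have := finiteDimensional_riemannRochSpace hC (D - Finsupp.single P 1)
  obtain ⟨f, hf⟩ := riemannRochSpace_le_sup (D := D) (P := P)
  calc D.ell ≤ _ := Submodule.finrank_mono hf
    _ ≤ _ := Submodule.finrank_add_le_finrank_add_finrank _ _
    _ ≤ _ := Nat.add_le_add_left ((finrank_span_le_card {f}).trans (by simp)) _

theorem ell_add_le {g : ℕ} (hC : C.HasGenus g) (D : C.Divisor) {F : C.Divisor} (hF : 0 ≤ F) :
    ((D + F).ell : ℤ) ≤ D.ell + F.degree := by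
  obtain ⟨n, hn⟩ := Int.eq_ofNat_of_zero_le (degree_nonneg hF)
  induction n generalizing F with
  | zero => rw [eq_zero_of_degree_eq_zero hF hn, degree_zero, add_zero, add_zero]
  | succ n ih =>
    obtain ⟨P, hP⟩ := exists_apply_ne_zero (F := F) (by omega)
    have h2 := ih (sub_single_nonneg hF hP) (by rw [degree_sub, degree_single, hn]; push_cast; ring)
    have h3 := ell_le_ell_sub_single_add_one hC (D + F) P
    rw [degree_sub, degree_single] at h2
    rw [add_sub_assoc] at h3
    omega

theorem exists_mem_of_ell_pos {D : C.Divisor} (h : 0 < D.ell) :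
    ∃ f ∈ D.riemannRochSpace, f ≠ 0 := by
  have : D.riemannRochSpace ≠ ⊥ := by
    intro h0
    rw [ell, h0, finrank_bot] at h
    exact lt_irrefl _ h
  exact Submodule.exists_mem_ne_zero_of_ne_bot this

theorem degree_le_ell {g : ℕ} (hC : C.HasGenus g) (D : C.Divisor) :
    D.degree + 1 - g ≤ D.ell := by
  have h := hC.2 ⟨D, rfl⟩
  dsimp only at h
  omega

/-- The Riemann-Roch theorem for divisors of large degree. If `D₀` attains the maximum in the
definition of the genus and `deg (D - D₀)` is large, then `D` is linearly equivalent to `D₀ + F`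
with `F ≥ 0`, and enlarging `D₀` by `F` increases `ℓ` by at most `deg F`. -/
theorem exists_forall_ell_eq {g : ℕ} (hC : C.HasGenus g) :
    ∃ N : ℤ, ∀ D : C.Divisor, N ≤ D.degree → (D.ell : ℤ) = D.degree + 1 - g := by
  obtain ⟨D₀, hD₀⟩ := hC.1
  dsimp only at hD₀
  refine ⟨D₀.degree + g, fun D hD => ?_⟩
  have h1 := degree_le_ell hC (D - D₀)
  rw [degree_sub] at h1
  obtain ⟨h, hh, h0⟩ := exists_mem_of_ell_pos (D := D - D₀) (by omega)
  have h2 := add_div_nonneg h0 hh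
  have h3 := ell_add_le hC D₀ h2
  rw [degree_add, degree_sub, degree_div hC h0] at h3
  have h4 : D₀ + (D - D₀ + div h) = D - div h⁻¹ := by rw [div_inv]; abel
  rw [h4, ell_sub_div D (inv_ne_zero h0)] at h3
  have h5 := degree_le_ell hC D
  omega

theorem exists_ord_eq_neg_of_ell_lt {D : C.Divisor} {P : closedPoints C.X}
    (h : (D - Finsupp.single P 1).ell < D.ell) :
    ∃ f ∈ D.riemannRochSpace, f ≠ 0 ∧ ord P f = -D P := by
  by_contra! h'
  have : D.riemannRochSpace ≤ (D - Finsupp.single P 1).riemannRochSpace := fun f hf =>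
    mem_riemannRochSpace_sub_single hf (h' f hf)
  have h2 : (D - Finsupp.single P 1).riemannRochSpace ≤ D.riemannRochSpace :=
    riemannRochSpace_mono (sub_le_self _ (Finsupp.single_nonneg.mpr zero_le_one))
  rw [ell, ell, le_antisymm this h2] at h
  exact lt_irrefl _ h

/-- A divisor of large degree has no base point. -/
theorem exists_forall_exists_ord_eq_neg {g : ℕ} (hC : C.HasGenus g) :
    ∃ N : ℤ, ∀ (D : C.Divisor) (P : closedPoints C.X), N ≤ D.degree →
      ∃ f ∈ D.riemannRochSpace, f ≠ 0 ∧ ord P f = -D P := by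
  obtain ⟨N, hN⟩ := exists_forall_ell_eq hC
  refine ⟨N + 1, fun D P hD => exists_ord_eq_neg_of_ell_lt ?_⟩
  have h1 := hN D (by omega)
  have h2 := hN (D - Finsupp.single P 1) (by rw [degree_sub, degree_single]; omega)
  rw [degree_sub, degree_single] at h2
  omega

/-- Functions without poles are constant. -/
theorem exists_eq_algebraMap_of_mem {g : ℕ} (hC : C.HasGenus g) {f : C.FunctionField}
    (hf : f ∈ (0 : C.Divisor).riemannRochSpace) : ∃ c : ℂ, f = algebraMap ℂ _ c := by
  obtain ⟨P⟩ := C.nonempty_closedPoints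
  have h1 : (1 : C.FunctionField) ∈ (0 : C.Divisor).riemannRochSpace :=
    (mem_riemannRochSpace_iff one_ne_zero).mpr fun P => by simp [ord_one]
  obtain ⟨c, hc⟩ := exists_sub_smul_mem (P := P) h1 one_ne_zero (by simp [ord_one]) hf
  rw [riemannRochSpace_eq_bot hC (by rw [degree_sub, degree_single, degree_zero]; omega),
    Submodule.mem_bot, sub_eq_zero] at hc
  exact ⟨c, by rw [hc, Algebra.smul_def, mul_one]⟩

theorem ell_zero {g : ℕ} (hC : C.HasGenus g) : (0 : C.Divisor).ell = 1 := by
  have h : (0 : C.Divisor).riemannRochSpace = ℂ ∙ (1 : C.FunctionField) := by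
    apply le_antisymm
    · intro f hf
      obtain ⟨c, rfl⟩ := exists_eq_algebraMap_of_mem hC hf
      exact Submodule.mem_span_singleton.mpr ⟨c, by rw [Algebra.smul_def, mul_one]⟩
    · rw [Submodule.span_singleton_le_iff_mem]
      exact (mem_riemannRochSpace_iff one_ne_zero).mpr fun P => by simp [ord_one]
  rw [ell, h, finrank_span_singleton one_ne_zero]

/-- A curve of genus one has no function with a single simple pole. -/
theorem ell_single_one (hC : C.HasGenus 1) (P : closedPoints C.X) :
    ell (Finsupp.single P 1 : C.Divisor) = 1 := by
  have hge := degree_le_ell hC (Finsupp.single P 1)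
  rw [degree_single] at hge
  by_contra hne
  obtain ⟨x, hx, hx0, hxP⟩ := exists_ord_eq_neg_of_ell_lt (D := Finsupp.single P 1) (P := P)
    (by rw [sub_self, ell_zero hC]; omega)
  -- the powers of `x` make `ℓ(nP)` exceed `n` for all `n`
  have key : ∀ n : ℕ, (n : ℤ) + 1 ≤ ell (Finsupp.single P (n : ℤ) : C.Divisor) := by
    intro n
    induction n with
    | zero => simp [ell_zero hC]
    | succ n ih =>
      have := finiteDimensional_riemannRochSpace hC (Finsupp.single P ((n + 1 : ℕ) : ℤ))
      have hlt : riemannRochSpace (Finsupp.single P (n : ℤ) : C.Divisor) <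
          riemannRochSpace (Finsupp.single P ((n + 1 : ℕ) : ℤ) : C.Divisor) := by
        refine lt_of_le_of_ne
          (riemannRochSpace_mono (Finsupp.single_le_single.mpr (by push_cast; omega))) fun h => ?_
        have hmem : x ^ (n + 1) ∈
            riemannRochSpace (Finsupp.single P ((n + 1 : ℕ) : ℤ) : C.Divisor) := by
          classical
          rw [mem_riemannRochSpace_iff hx0] at hx
          rw [mem_riemannRochSpace_iff (pow_ne_zero _ hx0)]
          intro Q
          have := hx Q
          rw [ord_pow]
          simp only [Finsupp.single_apply] at *
          push_cast
          split_ifs at * with h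
          · nlinarith
          · nlinarith
        rw [← h, mem_riemannRochSpace_iff (pow_ne_zero _ hx0)] at hmem
        have := hmem P
        rw [ord_pow, hxP] at this
        simp only [Finsupp.single_eq_same] at this
        push_cast at this
        omega
      have := Submodule.finrank_lt_finrank_of_lt hlt
      rw [ell] at ih ⊢
      push_cast
      push_cast at this
      omega
  obtain ⟨N, hN⟩ := exists_forall_ell_eq hC
  have h1 := key N.toNat
  have h2 := hN (Finsupp.single P (N.toNat : ℤ)) (by rw [degree_single]; omega)
  rw [degree_single] at h2
  omega

/-- On a curve of genus one every divisor of degree one is linearly equivalent to a point. -/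
theorem exists_add_div_eq_single (hC : C.HasGenus 1) {D : C.Divisor} (hD : D.degree = 1) :
    ∃ h : C.FunctionField, h ≠ 0 ∧ ∃ Q, D + div h = Finsupp.single Q 1 := by
  have h1 := degree_le_ell hC D
  obtain ⟨h, hh, h0⟩ := exists_mem_of_ell_pos (D := D) (by omega)
  exact ⟨h, h0, exists_eq_single (add_div_nonneg h0 hh)
    (by rw [degree_add, degree_div hC h0, hD, add_zero])⟩

/-- The Riemann-Roch theorem for divisors of positive degree on a curve of genus one. -/
theorem ell_eq_degree (hC : C.HasGenus 1) {D : C.Divisor} (hD : 1 ≤ D.degree) :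
    (D.ell : ℤ) = D.degree := by
  have hge := degree_le_ell hC D
  obtain ⟨P⟩ := C.nonempty_closedPoints
  let D' := D - Finsupp.single P (D.degree - 1)
  have hD' : D'.degree = 1 := by rw [degree_sub, degree_single]; omega
  obtain ⟨h, h0, Q, hQ⟩ := exists_add_div_eq_single hC hD'
  have h2 : D'.ell = 1 := by
    rw [← ell_single_one hC Q, ← hQ, ← ell_sub_div (D' + div h) h0, add_sub_cancel_right]
  have h3 := ell_add_le hC D' (F := Finsupp.single P (D.degree - 1))
    (Finsupp.single_nonneg.mpr (by omega))
  rw [sub_add_cancel, degree_single] at h3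
  omega

end NonsingularCurve

namespace NonsingularCurve

variable {C : NonsingularCurve}

/-! ### Proper open subsets are affine -/

open Divisor

theorem Divisor.degree_sum_single (S : Finset (closedPoints C.X)) (n : ℤ) :
    degree (∑ Q ∈ S, Finsupp.single Q n : C.Divisor) = S.card * n := by
  classical
  induction S using Finset.induction_on with
  | empty => simp [degree_zero]
  | insert Q S hQ ih =>
    rw [Finset.sum_insert hQ, degree_add, degree_single, ih, Finset.card_insert_of_notMem hQ]
    push_cast
    ring

theorem Divisor.sum_single_apply [DecidableEq (closedPoints C.X)] (S : Finset (closedPoints C.X))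
    (n : ℤ) (P : closedPoints C.X) :
    (∑ Q ∈ S, Finsupp.single Q n : C.Divisor) P = if P ∈ S then n else 0 := by
  rw [Finsupp.finsetSum_apply]
  simp [Finsupp.single_apply]

/-- There are functions with poles at most on `S` which vanish on `Z` and are units at `P`. -/
theorem exists_regular_function {g : ℕ} (hC : C.HasGenus g) {S Z : Finset (closedPoints C.X)}
    (hS : S.Nonempty) (hSZ : ∀ Q ∈ Z, Q ∉ S) {P : closedPoints C.X} (hPS : P ∉ S) (hPZ : P ∉ Z) :
    ∃ f : C.FunctionField, f ≠ 0 ∧ (∀ Q ∉ S, 0 ≤ ord Q f) ∧ (∀ Q ∈ Z, 0 < ord Q f) ∧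
      ord P f = 0 := by
  classical
  obtain ⟨N, hN⟩ := exists_forall_exists_ord_eq_neg hC
  let n : ℕ := N.toNat + Z.card
  let D : C.Divisor := ∑ Q ∈ S, Finsupp.single Q (n : ℤ) - ∑ Q ∈ Z, Finsupp.single Q 1
  have hD : ∀ Q, D Q = (if Q ∈ S then (n : ℤ) else 0) - if Q ∈ Z then 1 else 0 := fun Q => by
    rw [Finsupp.sub_apply, sum_single_apply, sum_single_apply]
  have hdeg : N ≤ D.degree := by
    rw [degree_sub, degree_sum_single, degree_sum_single, mul_one]
    have h1 : (1 : ℤ) ≤ S.card := by exact_mod_cast hS.card_pos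
    have h2 : (n : ℤ) = N.toNat + Z.card := by push_cast [n]; rfl
    nlinarith [Int.self_le_toNat N]
  obtain ⟨f, hf, hf0, hfP⟩ := hN D P hdeg
  rw [mem_riemannRochSpace_iff hf0] at hf
  refine ⟨f, hf0, fun Q hQ => ?_, fun Q hQ => ?_, ?_⟩
  · have := hf Q
    rw [hD, if_neg hQ] at this
    split_ifs at this <;> omega
  · have := hf Q
    rw [hD, if_neg (hSZ Q hQ), if_pos hQ] at this
    omega
  · rw [hfP, hD, if_neg hPS, if_neg hPZ]
    rfl

/-- There is a function with a pole at `P` and no poles outside `S`. -/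
theorem exists_function_with_pole {g : ℕ} (hC : C.HasGenus g) {S : Finset (closedPoints C.X)}
    {P : closedPoints C.X} (hP : P ∈ S) :
    ∃ f : C.FunctionField, f ≠ 0 ∧ (∀ Q ∉ S, 0 ≤ ord Q f) ∧ ord P f < 0 := by
  classical
  obtain ⟨N, hN⟩ := exists_forall_exists_ord_eq_neg hC
  obtain ⟨f, hf, hf0, hfP⟩ := hN (Finsupp.single P ((N.toNat + 1 : ℕ) : ℤ)) P
    (by rw [degree_single]; push_cast; omega)
  rw [mem_riemannRochSpace_iff hf0] at hf
  refine ⟨f, hf0, fun Q hQ => ?_, ?_⟩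
  · have := hf Q
    rwa [Finsupp.single_apply, if_neg (by rintro rfl; exact hQ hP), neg_zero] at this
  · rw [hfP, Finsupp.single_eq_same]
    omega

theorem exists_closedPoint_mem_opens (U : C.X.Opens) [hU : Nonempty U] :
    ∃ P : closedPoints C.X, P.1 ∈ U := by
  have := LocallyOfFiniteType.jacobsonSpace C.π
  obtain ⟨x, hxU, hx⟩ := nonempty_inter_closedPoints (Z := (U : Set C.X))
    ⟨hU.some.1, hU.some.2⟩ U.isOpen.isLocallyClosed
  exact ⟨⟨x, hx⟩, hxU⟩

theorem genericPoint_mem (U : C.X.Opens) [hU : Nonempty U] : genericPoint C.X ∈ U :=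
  ((genericPoint_spec C.X).mem_open_set_iff U.isOpen).mpr (by simpa using hU)

theorem valuation_eq_one_of_mem_basicOpen {U : C.X.Opens} [Nonempty U] (s : Γ(C.X, U))
    {P : closedPoints C.X} (hP : P.1 ∈ C.X.basicOpen s) :
    C.valuation P (C.X.germToFunctionField U s) = 1 := by
  have hPU : P.1 ∈ U := C.X.basicOpen_le s hP
  rw [← Scheme.algebraMap_germ_eq_germToFunctionField C.X (x := P.1) hPU]
  refine le_antisymm (valuation_le_one_iff.mpr ⟨_, rfl⟩) (not_lt.mp fun h => ?_)
  rw [valuation_algebraMap_lt_one_iff] at h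
  exact (IsLocalRing.mem_maximalIdeal _).mp h ((Scheme.mem_basicOpen C.X s P.1 hPU).mp hP)

/-- An open set which misses a closed point is covered by affine basic open sets: take a section
which is a unit at `P` and vanishes outside an affine neighbourhood of `P`. -/
theorem exists_section_isAffineOpen_basicOpen {g : ℕ} (hC : C.HasGenus g) {U : C.X.Opens}
    [Nonempty U] {Q : closedPoints C.X} (hQ : Q.1 ∉ U) {P : closedPoints C.X} (hP : P.1 ∈ U) :
    ∃ s : Γ(C.X, U), IsAffineOpen (C.X.basicOpen s) ∧ C.X.germToFunctionField U s ≠ 0 ∧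
      C.valuation P (C.X.germToFunctionField U s) = 1 := by
  classical
  obtain ⟨_, ⟨V, hV, rfl⟩, hPV, hVU⟩ :=
    C.X.isBasis_affineOpens.exists_subset_of_mem_open hP U.isOpen
  have hVne : Nonempty V := ⟨⟨P.1, hPV⟩⟩
  let S := (C.finite_closedPoints_notMem U ⟨P.1, hP⟩).toFinset
  let T := (C.finite_closedPoints_notMem V ⟨P.1, hPV⟩).toFinset
  have hS : ∀ R, R ∈ S ↔ R.1 ∉ U := fun R => by simp [S]
  have hT : ∀ R, R ∈ T ↔ R.1 ∉ V := fun R => by simp [T]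
  obtain ⟨f, hf0, hfS, hfZ, hfP⟩ := exists_regular_function hC (S := S) (Z := T \ S)
    ⟨Q, (hS Q).mpr hQ⟩ (fun R hR => (Finset.mem_sdiff.mp hR).2) (P := P)
    (fun h => (hS P).mp h hP) (fun h => (hT P).mp (Finset.mem_sdiff.mp h).1 hPV)
  obtain ⟨s, rfl⟩ := exists_section_of_valuation_le_one U (f := f) fun R hR =>
    (valuation_le_one_iff_ord hf0).mpr (hfS R fun h => (hS R).mp h hR)
  refine ⟨s, ?_, hf0, (valuation_eq_one_iff_ord hf0).mpr hfP⟩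
  have hle : C.X.basicOpen s ≤ V := by
    intro x hx
    rcases C.eq_genericPoint_or_mem_closedPoints x with h | h
    · exact h ▸ genericPoint_mem V
    · by_contra hxV
      have h1 := valuation_eq_one_of_mem_basicOpen s (P := ⟨x, h⟩) hx
      rw [valuation_eq_one_iff_ord hf0] at h1
      have := hfZ ⟨x, h⟩ (Finset.mem_sdiff.mpr ⟨(hT _).mpr hxV, fun h' => (hS _).mp h'
        (C.X.basicOpen_le s hx)⟩)
      omega
  have h2 := Scheme.basicOpen_res C.X s (homOfLE hVU).op
  rw [inf_eq_right.mpr hle] at h2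
  rw [← h2]
  exact hV.basicOpen _

/-- A nonempty open set which misses a closed point is affine. It is enough that the sections `s`
with affine basic open set generate the unit ideal of the ring of sections. Otherwise a valuation
ring containing that ring has them all among its nonunits; it is the local ring at a closed point
`P`, but if `P ∈ U` then one of these sections is a unit at `P`, and if `P ∉ U` then some section
has a pole at `P`. -/
theorem isAffineOpen_of_notMem {g : ℕ} (hC : C.HasGenus g) {U : C.X.Opens} [Nonempty U]
    {Q : closedPoints C.X} (hQ : Q.1 ∉ U) : IsAffineOpen U := by
  classical
  refine isAffineOpen_of_isAffineOpen_basicOpen U {s | IsAffineOpen (C.X.basicOpen s)} ?_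
    fun s hs => hs
  by_contra hI
  let I := Ideal.span {s : Γ(C.X, U) | IsAffineOpen (C.X.basicOpen s)}
  let φ := (C.X.germToFunctionField U).hom
  let e : Γ(C.X, U) ≃+* φ.range :=
    RingEquiv.ofBijective φ.rangeRestrict ⟨fun a b h =>
      C.X.germToFunctionField_injective U (congrArg Subtype.val h), φ.rangeRestrict_surjective⟩
  have hI' : I.comap (e.symm : φ.range →+* Γ(C.X, U)) ≠ ⊤ := by
    rwa [Ne, Ideal.comap_eq_top_iff]
  obtain ⟨B, hAB, hB⟩ := Ideal.image_subset_nonunits_valuationSubring _ hI'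
  have hmemB : ∀ f : C.FunctionField,
      (∀ P : closedPoints C.X, P.1 ∈ U → C.valuation P f ≤ 1) → f ∈ B := by
    intro f hf
    obtain ⟨s, rfl⟩ := exists_section_of_valuation_le_one U hf
    exact hAB ⟨s, rfl⟩
  -- the sections with affine basic open set are not invertible in `B`
  have hsB : ∀ s : Γ(C.X, U), IsAffineOpen (C.X.basicOpen s) →
      C.X.germToFunctionField U s ∈ B.nonunits := by
    intro s hs
    refine hB ⟨e s, ?_, rfl⟩
    change e.symm (e s) ∈ I
    rw [e.symm_apply_apply]
    exact Ideal.subset_span hs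
  have hunit : ∀ f : C.FunctionField, f ≠ 0 → f ∈ B.nonunits → f⁻¹ ∉ B := by
    intro f hf0 hf hfB
    rw [ValuationSubring.mem_nonunits_iff] at hf
    rw [← ValuationSubring.valuation_le_one_iff, map_inv₀] at hfB
    have h0 : B.valuation f ≠ 0 := (Valuation.ne_zero_iff _).mpr hf0
    exact absurd hf (not_lt.mpr ((inv_le_one₀ (zero_lt_iff.mpr h0)).mp hfB))
  have hne : B ≠ ⊤ := by
    rintro rfl
    obtain ⟨P, hP⟩ := exists_closedPoint_mem_opens U
    obtain ⟨s, hs, hs0, -⟩ := exists_section_isAffineOpen_basicOpen hC hQ hP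
    exact hunit _ hs0 (hsB s hs) trivial
  obtain ⟨P, hP⟩ := exists_valuation_le_one_iff_mem B
    (fun c => hmemB _ fun P _ => C.valuation_const_le_one P c) hne
  by_cases hPU : P.1 ∈ U
  · obtain ⟨s, hs, hs0, hs1⟩ := exists_section_isAffineOpen_basicOpen hC hQ hPU
    refine hunit _ hs0 (hsB s hs) ((hP _).mp ?_)
    rw [map_inv₀, hs1, inv_one]
  · let S := (C.finite_closedPoints_notMem U ⟨_, genericPoint_mem U⟩).toFinset
    have hS : ∀ R, R ∈ S ↔ R.1 ∉ U := fun R => by simp [S]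
    obtain ⟨f, hf0, hfS, hfP⟩ := exists_function_with_pole hC (S := S) ((hS P).mpr hPU)
    have := (hP f).mpr (hmemB f fun R hR =>
      (valuation_le_one_iff_ord hf0).mpr (hfS R fun h => (hS R).mp h hR))
    rw [valuation_le_one_iff_ord hf0] at this
    omega

end NonsingularCurve

namespace NonsingularCurve

variable {C E : NonsingularCurve} (f : C.X ⟶ E.X)

/-! ### Dominant morphisms and function fields -/

theorem map_genericPoint [IsDominant f] : f (genericPoint C.X) = genericPoint E.X := by
  have h := (genericPoint_spec C.X).image f.continuous
  rw [Set.image_univ, f.denseRange.closure_range] at h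
  exact h.eq (genericPoint_spec E.X)

theorem isProper_of_comp_eq (hf : f ≫ E.π = C.π) : IsProper f := by
  have : IsProper (f ≫ E.π) := hf ▸ C.isProper
  exact IsProper.of_comp f E.π

/-- The homomorphism `ℂ(E) → ℂ(C)` of function fields induced by a dominant morphism `C → E`. -/
def pullback [IsDominant f] : E.FunctionField →+* C.FunctionField :=
  (E.X.presheaf.stalkSpecializes (specializes_of_eq (map_genericPoint f)) ≫
    f.stalkMap (genericPoint C.X)).hom

theorem pullback_algebraMap [IsDominant f] (x : C.X) (a : E.X.presheaf.stalk (f x)) :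
    pullback f (algebraMap _ _ a) = algebraMap _ C.FunctionField (f.stalkMap x a) := by
  have hx : genericPoint C.X ⤳ x := genericPoint_specializes _
  have h := Scheme.Hom.stalkSpecializes_stalkMap f _ _ hx
  have h2 : E.X.presheaf.stalkSpecializes (genericPoint_specializes (f x)) ≫
      E.X.presheaf.stalkSpecializes (specializes_of_eq (map_genericPoint f)) =
      E.X.presheaf.stalkSpecializes (hx.map f.continuous) :=
    TopCat.Presheaf.stalkSpecializes_comp _ _ _
  rw [← h2, Category.assoc] at h
  exact ConcreteCategory.congr_hom h a

theorem pullback_germToFunctionField [IsDominant f] (U : E.X.Opens) [Nonempty U]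
    [Nonempty (f ⁻¹ᵁ U)] (s : Γ(E.X, U)) :
    pullback f (E.X.germToFunctionField U s) = C.X.germToFunctionField (f ⁻¹ᵁ U) (f.app U s) := by
  have hx : genericPoint C.X ∈ f ⁻¹ᵁ U := genericPoint_mem _
  have h := Scheme.Hom.germ_stalkMap f U _ hx
  have h2 : E.X.germToFunctionField U ≫
      E.X.presheaf.stalkSpecializes (specializes_of_eq (map_genericPoint f)) =
      E.X.presheaf.germ U _ hx := TopCat.Presheaf.germ_stalkSpecializes _ _ _
  rw [← h2, Category.assoc] at h
  exact ConcreteCategory.congr_hom h s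

/-- The stalk maps of a morphism over `ℂ` preserve constants. -/
theorem stalkMap_const (hf : f ≫ E.π = C.π) (x : C.X) (c : ℂ) :
    f.stalkMap x (E.const (f x) c) = C.const x c := by
  have : CommRingCat.ofHom (E.const (f x)) ≫ f.stalkMap x = CommRingCat.ofHom (C.const x) := by
    apply Spec.map_injective
    rw [Spec.map_comp, specMap_const, specMap_const, ← hf,
      Scheme.SpecMap_stalkMap_fromSpecStalk_assoc]
  exact ConcreteCategory.congr_hom this c

theorem pullback_const [IsDominant f] (hf : f ≫ E.π = C.π) (c : ℂ) :
    pullback f (algebraMap ℂ _ c) = algebraMap ℂ _ c := by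
  rw [← E.algebraMap_const (f (genericPoint C.X)) c, pullback_algebraMap, stalkMap_const f hf,
    C.algebraMap_const]

/-- The degree of `f` is the degree of `ℂ(C)` over `ℂ(E)`, where the local ring of `E` at the image
of the generic point is identified with `ℂ(E)`. -/
theorem finrank_pullback [IsDominant f] {n : ℕ} (h : HasDegree f n) :
    letI : Algebra E.FunctionField C.FunctionField := (pullback f).toAlgebra
    Module.finrank E.FunctionField C.FunctionField = n := by
  refine Eq.trans ?_ h.2
  let e := E.X.presheaf.stalkCongr (Inseparable.of_eq (map_genericPoint f))
  refine @Algebra.finrank_eq_of_equiv_equiv _ _ _ _ (_) _ _ _ _ (_)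
    e.symm.commRingCatIsoToRingEquiv (RingEquiv.refl _) ?_
  rfl

theorem map_mem_closedPoints [IsProper f] {Q : C.X} (hQ : Q ∈ closedPoints C.X) :
    f Q ∈ closedPoints E.X := by
  have := f.isClosedMap {Q} hQ
  rwa [Set.image_singleton] at this

/-- The map on closed points induced by a proper morphism. -/
def mapClosedPoint [IsProper f] (Q : closedPoints C.X) : closedPoints E.X :=
  ⟨f Q.1, map_mem_closedPoints f Q.2⟩

theorem mapClosedPoint_surjective [IsProper f] [IsDominant f] :
    Function.Surjective (mapClosedPoint f) := by
  intro P
  have hs : Function.Surjective f := by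
    rw [← Set.range_eq_univ, ← f.denseRange.closure_range, f.isClosedMap.isClosed_range.closure_eq]
  obtain ⟨Q, hQ⟩ := C.exists_closedPoint_mem (P.2.preimage f.continuous)
    ((Set.singleton_nonempty P.1).preimage hs)
  exact ⟨Q, Subtype.ext hQ⟩

theorem pullback_valuation_le_one [IsProper f] [IsDominant f] (Q : closedPoints C.X)
    {z : E.FunctionField} (hz : E.valuation (mapClosedPoint f Q) z ≤ 1) :
    C.valuation Q (pullback f z) ≤ 1 := by
  obtain ⟨a, rfl⟩ := valuation_le_one_iff.mp hz
  exact valuation_le_one_iff.mpr ⟨_, (pullback_algebraMap f Q.1 a).symm⟩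

theorem pullback_valuation_lt_one [IsProper f] [IsDominant f] (Q : closedPoints C.X)
    {z : E.FunctionField} (hz : E.valuation (mapClosedPoint f Q) z < 1) :
    C.valuation Q (pullback f z) < 1 := by
  obtain ⟨a, rfl⟩ := valuation_le_one_iff.mp hz.le
  refine lt_of_eq_of_lt (congrArg _ (pullback_algebraMap f Q.1 a)) ?_
  rw [valuation_algebraMap_lt_one_iff] at hz ⊢
  rw [IsLocalRing.mem_maximalIdeal, mem_nonunits_iff] at hz ⊢
  exact fun h => hz ((f.prop Q.1).map_nonunit a h)

/-- The order of `f^* z` at `Q` is the order of `z` at `f(Q)` multiplied by a positive integer, the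
ramification index. -/
theorem exists_ord_pullback [IsProper f] [IsDominant f] (Q : closedPoints C.X) :
    ∃ e : ℤ, 1 ≤ e ∧ ∀ z : E.FunctionField,
      ord Q (pullback f z) = e * ord (mapClosedPoint f Q) z := by
  obtain ⟨π, hπ, hπ1⟩ := exists_ord_eq_one (mapClosedPoint f Q)
  have hπ' : pullback f π ≠ 0 := (map_ne_zero _).mpr hπ
  have h0 : ∀ z : E.FunctionField, z ≠ 0 → ord (mapClosedPoint f Q) z = 0 →
      ord Q (pullback f z) = 0 := by
    have key : ∀ z : E.FunctionField, z ≠ 0 → ord (mapClosedPoint f Q) z = 0 →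
        0 ≤ ord Q (pullback f z) := fun z hz hz0 =>
      (valuation_le_one_iff_ord ((map_ne_zero _).mpr hz)).mp (pullback_valuation_le_one f Q
        ((valuation_le_one_iff_ord hz).mpr hz0.ge))
    intro z hz hz0
    have h1 := key z hz hz0
    have h2 := key z⁻¹ (inv_ne_zero hz) (by rw [ord_inv, hz0, neg_zero])
    rw [map_inv₀, ord_inv] at h2
    omega
  refine ⟨ord Q (pullback f π), ?_, fun z => ?_⟩
  · exact (valuation_lt_one_iff_ord hπ').mp (pullback_valuation_lt_one f Q
      ((valuation_lt_one_iff_ord hπ).mpr (by omega)))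
  · rcases eq_or_ne z 0 with rfl | hz
    · simp [ord]
    · have h1 := h0 (z * π ^ (-ord (mapClosedPoint f Q) z)) (mul_ne_zero hz (zpow_ne_zero _ hπ))
        (by rw [ord_mul hz (zpow_ne_zero _ hπ), ord_zpow, hπ1]; ring)
      rw [map_mul, map_zpow₀, ord_mul ((map_ne_zero _).mpr hz) (zpow_ne_zero _ hπ'), ord_zpow] at h1
      linarith

end NonsingularCurve

/-! ### Quadratic field extensions -/

/-- `L` is generated over `K` (embedded by `φ`) by a square root `δ ∉ K` of `d ∈ K`. -/
structure IsSqrtGenerator {K L : Type*} [Field K] [Field L] (φ : K →+* L) (d : K) (δ : L) :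
    Prop where
  sq : δ ^ 2 = φ d
  map_ne : ∀ a, φ a ≠ δ
  exists_eq : ∀ z, ∃ a b, z = φ a + φ b * δ

namespace IsSqrtGenerator

variable {K L : Type*} [Field K] [Field L] {φ : K →+* L}

theorem exists_of_finrank_eq_two [CharZero K] (φ : K →+* L)
    (h : letI := φ.toAlgebra; Module.finrank K L = 2) : ∃ d δ, IsSqrtGenerator φ d δ := by
  let := φ.toAlgebra
  have hfin : FiniteDimensional K L := Module.finite_of_finrank_pos (by omega)
  have hφ : ∀ a, algebraMap K L a = φ a := fun _ => rfl
  have h0 : ∃ δ : L, ∀ a, φ a ≠ δ := by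
    by_contra! h0
    have : Module.finrank K L = 1 := finrank_eq_one (1 : L) one_ne_zero fun w => by
      obtain ⟨a, ha⟩ := h0 w
      exact ⟨a, by rw [Algebra.smul_def, mul_one, hφ, ha]⟩
    omega
  obtain ⟨δ, hδ⟩ := h0
  have hli : LinearIndependent K ![1, δ] := by
    rw [LinearIndependent.pair_iff]
    intro s t hst
    rw [Algebra.smul_def, Algebra.smul_def, hφ, hφ, mul_one] at hst
    have ht : t = 0 := by
      by_contra ht
      have ht' : φ t ≠ 0 := (map_ne_zero φ).mpr ht
      apply hδ (-s / t)
      rw [map_div₀, map_neg, div_eq_iff ht']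
      linear_combination -hst
    subst ht
    rw [map_zero, zero_mul, add_zero, map_eq_zero] at hst
    exact ⟨hst, rfl⟩
  have hspan := hli.span_eq_top_of_card_eq_finrank' (by rw [h]; rfl)
  have hex : ∀ z, ∃ a b, z = φ a + φ b * δ := by
    intro z
    have hz : z ∈ Submodule.span K (Set.range ![1, δ]) := hspan ▸ Submodule.mem_top
    rw [Matrix.range_cons, Matrix.range_cons, Matrix.range_empty, Set.union_empty,
      Set.singleton_union, Submodule.mem_span_pair] at hz
    obtain ⟨a, b, rfl⟩ := hz
    exact ⟨a, b, by rw [Algebra.smul_def, Algebra.smul_def, hφ, hφ, mul_one]⟩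
  -- complete the square
  obtain ⟨a, b, hab⟩ := hex (δ ^ 2)
  have h2 : (2 : L) ≠ 0 := by
    rw [← map_ofNat φ 2]
    exact (map_ne_zero φ).mpr two_ne_zero
  have h2' : φ (b / 2) * 2 = φ b := by
    rw [map_div₀, map_ofNat, div_mul_cancel₀ _ h2]
  refine ⟨a + (b / 2) ^ 2, δ - φ (b / 2), ?_, fun c hc => hδ (c + b / 2) ?_, fun z => ?_⟩
  · rw [map_add, map_pow]
    linear_combination hab - h2' * δ
  · rw [map_add]
    linear_combination hc
  · obtain ⟨u, v, rfl⟩ := hex z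
    refine ⟨u + v * (b / 2), v, ?_⟩
    rw [map_add, map_mul]
    ring

variable {d : K} {δ : L} (h : IsSqrtGenerator φ d δ)
include h

theorem ne_zero : δ ≠ 0 := fun h0 => h.map_ne 0 (by rw [map_zero, h0])

theorem d_ne_zero : d ≠ 0 := by
  intro h0
  have := h.sq
  rw [h0, map_zero] at this
  exact h.ne_zero (pow_eq_zero_iff two_ne_zero |>.mp this)

theorem eq_zero_of_add_eq_zero {a b : K} (hab : φ a + φ b * δ = 0) : a = 0 ∧ b = 0 := by
  have hb : b = 0 := by
    by_contra hb
    have hb' : φ b ≠ 0 := (map_ne_zero φ).mpr hb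
    apply h.map_ne (-a / b)
    rw [map_div₀, map_neg, div_eq_iff hb']
    linear_combination -hab
  subst hb
  rw [map_zero, zero_mul, add_zero, map_eq_zero] at hab
  exact ⟨hab, rfl⟩

theorem eq_of_add_eq_add {a b a' b' : K} (hab : φ a + φ b * δ = φ a' + φ b' * δ) :
    a = a' ∧ b = b' := by
  have := h.eq_zero_of_add_eq_zero (a := a - a') (b := b - b') (by
    rw [map_sub, map_sub]
    linear_combination hab)
  exact ⟨sub_eq_zero.mp this.1, sub_eq_zero.mp this.2⟩

/-- The conjugation `a + b δ ↦ a - b δ` is a ring homomorphism. -/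
theorem exists_conj : ∃ σ : L →+* L, ∀ a b, σ (φ a + φ b * δ) = φ a - φ b * δ := by
  choose re im hz using h.exists_eq
  have key : ∀ {z : L} {a b : K}, z = φ a + φ b * δ → φ (re z) - φ (im z) * δ = φ a - φ b * δ := by
    intro z a b hab
    obtain ⟨h1, h2⟩ := h.eq_of_add_eq_add ((hz z).symm.trans hab)
    rw [h1, h2]
  refine ⟨{ toFun := fun z => φ (re z) - φ (im z) * δ
            map_one' := ?_, map_mul' := ?_, map_zero' := ?_, map_add' := ?_ }, fun a b => key rfl⟩
  · rw [key (a := 1) (b := 0) (by simp)]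
    simp
  · intro z w
    rw [key (z := z * w) (a := re z * re w + im z * im w * d) (b := re z * im w + im z * re w)]
    · simp only [map_add, map_mul]
      linear_combination -φ (im z) * φ (im w) * h.sq
    · conv_lhs => rw [hz z, hz w]
      simp only [map_add, map_mul]
      linear_combination φ (im z) * φ (im w) * h.sq
  · change φ (re 0) - φ (im 0) * δ = 0
    rw [key (z := 0) (a := 0) (b := 0) (by simp)]
    simp
  · intro z w
    rw [key (z := z + w) (a := re z + re w) (b := im z + im w)]
    · simp only [map_add]
      ring
    · conv_lhs => rw [hz z, hz w]
      simp only [map_add]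
      ring

theorem mul_map {c : K} (hc : c ≠ 0) : IsSqrtGenerator φ (d * c ^ 2) (δ * φ c) := by
  have hc' : φ c ≠ 0 := (map_ne_zero φ).mpr hc
  refine ⟨by rw [mul_pow, h.sq, map_mul, map_pow], fun a ha => h.map_ne (a / c) ?_, fun z => ?_⟩
  · rw [map_div₀, ha, mul_div_cancel_right₀ _ hc']
  · obtain ⟨a, b, rfl⟩ := h.exists_eq z
    refine ⟨a, b / c, ?_⟩
    rw [map_div₀]
    field_simp

end IsSqrtGenerator

namespace NonsingularCurve

open Divisor

variable {C E : NonsingularCurve} {f : C.X ⟶ E.X}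

/-! ### Double covers -/

section

variable [IsProper f] [IsDominant f] (hf : f ≫ E.π = C.π) {g : ℕ} (hE : E.HasGenus g)
  {d : E.FunctionField} {δ : C.FunctionField} (hδ : IsSqrtGenerator (pullback f) d δ)
include hf hE hδ

/-- Conjugation permutes the points of `C` over a point of `E`: the conjugate of the local ring at
`Q` is the local ring at some `Q'`, and a function with its only pole at `f(Q')` shows that
`f(Q') = f(Q)`. -/
theorem exists_conj_closedPoint (σ : C.FunctionField →+* C.FunctionField)
    (hσ : ∀ a b, σ (pullback f a + pullback f b * δ) = pullback f a - pullback f b * δ)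
    (Q : closedPoints C.X) : ∃ Q' : closedPoints C.X, mapClosedPoint f Q' = mapClosedPoint f Q ∧
      ∀ z, C.valuation Q' z ≤ 1 ↔ C.valuation Q (σ z) ≤ 1 := by
  have hσK : ∀ a, σ (pullback f a) = pullback f a := fun a => by simpa using hσ a 0
  have hσσ : ∀ z, σ (σ z) = z := fun z => by
    obtain ⟨a, b, rfl⟩ := hδ.exists_eq z
    rw [hσ, map_sub, map_mul, hσK, hσK]
    have := hσ 0 1
    simp only [map_zero, map_one, zero_add, one_mul, zero_sub] at this
    rw [this]
    ring
  let R := (C.valuation Q).valuationSubring.comap σ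
  have hR : ∀ z, z ∈ R ↔ C.valuation Q (σ z) ≤ 1 := fun z => Iff.rfl
  have hc : ∀ c : ℂ, algebraMap ℂ C.FunctionField c ∈ R := fun c => by
    rw [hR, ← pullback_const f hf, hσK, pullback_const f hf]
    exact C.valuation_const_le_one Q c
  have hne : R ≠ ⊤ := by
    intro h
    obtain ⟨z, hz, hzQ⟩ := exists_ord_eq Q (-1)
    have h1 := (hR (σ z)).mp (h ▸ trivial)
    rw [hσσ, valuation_le_one_iff_ord hz] at h1
    omega
  obtain ⟨Q', hQ'⟩ := exists_valuation_le_one_iff_mem R hc hne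
  refine ⟨Q', ?_, fun z => (hQ' z).trans (hR z)⟩
  by_contra hPP
  obtain ⟨z, hz0, hz, hzP⟩ := exists_function_with_pole hE (S := {mapClosedPoint f Q'})
    (Finset.mem_singleton_self _)
  have h1 := hz (mapClosedPoint f Q) (fun h => hPP (Finset.mem_singleton.mp h).symm)
  have h2 := pullback_valuation_le_one f Q ((valuation_le_one_iff_ord hz0).mpr h1)
  rw [← hσK, ← hR, ← hQ', valuation_le_one_iff_ord ((map_ne_zero _).mpr hz0)] at h2
  obtain ⟨e, he, heq⟩ := exists_ord_pullback f Q'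
  rw [heq] at h2
  nlinarith

/-- A function `z = a + b δ` is regular at all points over `P` iff `a` and `b² d` are regular at
`P`: if `z` is regular there, then so are its conjugate `z'`, `a = (z + z') / 2` and
`b² d = (z - a)²`. -/
theorem forall_valuation_le_one_iff {P : closedPoints E.X} {a b : E.FunctionField} :
    (∀ Q, mapClosedPoint f Q = P → C.valuation Q (pullback f a + pullback f b * δ) ≤ 1) ↔
      E.valuation P a ≤ 1 ∧ E.valuation P (b ^ 2 * d) ≤ 1 := by
  have hsq : ∀ b : E.FunctionField, (pullback f b * δ) ^ 2 = pullback f (b ^ 2 * d) := fun b => by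
    rw [mul_pow, hδ.sq, map_mul, map_pow]
  constructor
  · intro h
    obtain ⟨σ, hσ⟩ := hδ.exists_conj
    obtain ⟨Q, rfl⟩ := mapClosedPoint_surjective f P
    obtain ⟨Q', hQ', hv⟩ := exists_conj_closedPoint hf hE hδ σ hσ Q
    have h1 := h Q rfl
    have h2 := (hv _).mp (h Q' hQ')
    rw [hσ] at h2
    have hdescend : ∀ z : E.FunctionField, C.valuation Q (pullback f z) ≤ 1 →
        E.valuation (mapClosedPoint f Q) z ≤ 1 := by
      intro z hz
      rcases eq_or_ne z 0 with rfl | hz0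
      · simp
      · rw [valuation_le_one_iff_ord ((map_ne_zero _).mpr hz0)] at hz
        rw [valuation_le_one_iff_ord hz0]
        obtain ⟨e, he, heq⟩ := exists_ord_pullback f Q
        rw [heq] at hz
        by_contra hlt
        nlinarith
    have ha : C.valuation Q (pullback f a) ≤ 1 := by
      have h3 : pullback f a = algebraMap ℂ C.FunctionField (1 / 2) *
          ((pullback f a + pullback f b * δ) + (pullback f a - pullback f b * δ)) := by
        rw [map_div₀, map_one, map_ofNat]
        field_simp
        ring
      rw [h3, map_mul]
      exact mul_le_one' (C.valuation_const_le_one Q _) ((C.valuation Q).map_add_le h1 h2)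
    refine ⟨hdescend a ha, hdescend _ ?_⟩
    rw [← hsq, map_pow]
    refine pow_le_one' ?_ 2
    have h3 := (C.valuation Q).map_sub_le h1 ha
    rwa [add_sub_cancel_left] at h3
  · rintro ⟨ha, hb⟩ Q rfl
    refine (C.valuation Q).map_add_le (pullback_valuation_le_one f Q ha) ?_
    have h1 := pullback_valuation_le_one f Q hb
    rwa [← hsq, map_pow, pow_le_one_iff two_ne_zero] at h1

end

end NonsingularCurve

/-! ### Fibres and the genus formula for double covers -/

namespace NonsingularCurve

open Divisor

/-- The complement of a closed point, as an open subset. -/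
def complement {C : NonsingularCurve} (P : closedPoints C.X) : C.X.Opens :=
  ⟨{P.1}ᶜ, P.2.isOpen_compl⟩

theorem genericPoint_mem_complement {C : NonsingularCurve} (P : closedPoints C.X) :
    genericPoint C.X ∈ complement P := fun h =>
  C.genericPoint_notMem_closedPoints (by rw [Set.mem_singleton_iff.mp h]; exact P.2)

/-- The condition at `P` which defines `L(D)` says that `z t` is regular, for any `t` of order
`D(P)`. -/
theorem valuation_mul_le_one_iff {C : NonsingularCurve} {P : closedPoints C.X}
    {z t : C.FunctionField} (ht : t ≠ 0) :
    C.valuation P (z * t) ≤ 1 ↔ C.valuation P z ≤ WithZero.exp (ord P t) := by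
  rcases eq_or_ne z 0 with rfl | hz
  · simp
  · rw [valuation_le_one_iff_ord (mul_ne_zero hz ht), ord_mul hz ht, valuation_le_exp_iff hz]
    omega

variable {C E : NonsingularCurve} {f : C.X ⟶ E.X}

section

variable [IsProper f] [IsDominant f]

variable (f) in
/-- The ramification index of `f` at `Q`. -/
def ramificationIndex (Q : closedPoints C.X) : ℤ := (exists_ord_pullback f Q).choose

theorem one_le_ramificationIndex (Q : closedPoints C.X) : 1 ≤ ramificationIndex f Q :=
  (exists_ord_pullback f Q).choose_spec.1

theorem ord_pullback (Q : closedPoints C.X) (z : E.FunctionField) :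
    ord Q (pullback f z) = ramificationIndex f Q * ord (mapClosedPoint f Q) z :=
  (exists_ord_pullback f Q).choose_spec.2 z

omit [IsProper f] in
theorem genericPoint_mem_preimage_complement (P : closedPoints E.X) :
    genericPoint C.X ∈ f ⁻¹ᵁ complement P := by
  change f (genericPoint C.X) ∈ complement P
  rw [map_genericPoint]
  exact genericPoint_mem_complement P

theorem finite_fiber (P : closedPoints E.X) : {Q | mapClosedPoint f Q = P}.Finite := by
  refine (C.finite_closedPoints_notMem (f ⁻¹ᵁ complement P)
    ⟨_, genericPoint_mem_preimage_complement P⟩).subset fun Q hQ hQ' => ?_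
  exact hQ' (congrArg Subtype.val hQ)

open Classical in
variable (f) in
/-- The divisor `f^* P = ∑ e_Q Q`, the sum over the points `Q` over `P`. -/
def pullbackPoint (P : closedPoints E.X) : C.Divisor :=
  Finsupp.ofSupportFinite (fun Q => if mapClosedPoint f Q = P then ramificationIndex f Q else 0)
    ((finite_fiber P).subset fun Q hQ => by
      by_contra h
      exact hQ (if_neg h))

open Classical in
theorem pullbackPoint_apply (P : closedPoints E.X) (Q : closedPoints C.X) :
    pullbackPoint f P Q = if mapClosedPoint f Q = P then ramificationIndex f Q else 0 := rfl

theorem pullbackPoint_nonneg (P : closedPoints E.X) : 0 ≤ pullbackPoint f P := fun Q => by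
  rw [pullbackPoint_apply]
  have := one_le_ramificationIndex (f := f) Q
  split_ifs
  · change (0 : ℤ) ≤ _
    omega
  · rfl

end

/-- The map `(a, b) ↦ a + b δ`. -/
def decomposition [IsDominant f] (hf : f ≫ E.π = C.π) (δ : C.FunctionField) :
    E.FunctionField × E.FunctionField →ₗ[ℂ] C.FunctionField where
  toFun p := pullback f p.1 + pullback f p.2 * δ
  map_add' p q := by
    simp only [Prod.fst_add, Prod.snd_add, map_add]
    ring
  map_smul' c p := by
    have h : ∀ a : E.FunctionField, pullback f (c • a) = c • pullback f a := fun a => by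
      rw [Algebra.smul_def, map_mul, pullback_const f hf, Algebra.smul_def]
    rw [Prod.smul_fst, Prod.smul_snd, h, h, smul_mul_assoc, ← smul_add, RingHom.id_apply]

/-- The divisor `⌊div d / 2⌋`, with the orders at all points divided by two and rounded down. -/
def halfDiv (d : E.FunctionField) : E.Divisor := (div d).mapRange (· / 2) rfl

theorem halfDiv_apply (d : E.FunctionField) (P : closedPoints E.X) : halfDiv d P = ord P d / 2 :=
  rfl

section

variable [IsProper f] [IsDominant f] (hf : f ≫ E.π = C.π) {g : ℕ} (hE : E.HasGenus g)
  {d : E.FunctionField} {δ : C.FunctionField} (hδ : IsSqrtGenerator (pullback f) d δ)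
include hf hE hδ

/-- `L(n f^*P₀)` consists of the `a + b δ` with `a ∈ L(nP₀)` and `b ∈ L(nP₀ + ⌊div d / 2⌋)`: after
multiplication by a function of `E` with the order prescribed at a point, this is the criterion
for regularity over that point. -/
theorem mem_riemannRochSpace_pullback (P₀ : closedPoints E.X) (n : ℕ) (a b : E.FunctionField) :
    pullback f a + pullback f b * δ ∈ (n • pullbackPoint f P₀).riemannRochSpace ↔
      a ∈ riemannRochSpace (Finsupp.single P₀ (n : ℤ) : E.Divisor) ∧
      b ∈ riemannRochSpace (Finsupp.single P₀ (n : ℤ) + halfDiv d) := by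
  classical
  choose t ht0 ht using fun P : closedPoints E.X =>
    exists_ord_eq P ((Finsupp.single P₀ (n : ℤ) : E.Divisor) P)
  have h1 : ∀ (z : C.FunctionField), z ∈ (n • pullbackPoint f P₀).riemannRochSpace ↔
      ∀ P Q, mapClosedPoint f Q = P → C.valuation Q (z * pullback f (t P)) ≤ 1 := by
    intro z
    have : z ∈ (n • pullbackPoint f P₀).riemannRochSpace ↔
      ∀ Q, C.valuation Q z ≤ WithZero.exp ((n • pullbackPoint f P₀) Q) := Iff.rfl
    rw [this, forall_comm]
    refine forall_congr' fun Q => ?_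
    rw [forall_eq', valuation_mul_le_one_iff ((map_ne_zero _).mpr (ht0 _)), ord_pullback, ht,
      Finsupp.smul_apply, pullbackPoint_apply, Finsupp.single_apply]
    simp only [eq_comm (a := P₀)]
    split_ifs
    · rw [nsmul_eq_mul, mul_comm]
    · simp
  rw [h1]
  have h2 : ∀ P, (pullback f a + pullback f b * δ) * pullback f (t P) =
      pullback f (a * t P) + pullback f (b * t P) * δ := fun P => by
    rw [map_mul, map_mul]
    ring
  simp only [h2, forall_valuation_le_one_iff hf hE hδ]
  rw [forall_and]
  refine and_congr (forall_congr' fun P => ?_) (forall_congr' fun P => ?_)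
  · rw [valuation_mul_le_one_iff (ht0 P), ht]
  · rcases eq_or_ne b 0 with rfl | hb
    · simp
    · rw [valuation_le_exp_iff hb, Finsupp.add_apply, ← ht, halfDiv_apply,
        valuation_le_one_iff_ord (mul_ne_zero (pow_ne_zero 2 (mul_ne_zero hb (ht0 P)))
          hδ.d_ne_zero), ord_mul (pow_ne_zero 2 (mul_ne_zero hb (ht0 P))) hδ.d_ne_zero, ord_pow,
        ord_mul hb (ht0 P)]
      push_cast
      omega

/-- `ℓ(n f^*P₀) = ℓ(nP₀) + ℓ(nP₀ + ⌊div d / 2⌋)`. -/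
theorem ell_pullback (P₀ : closedPoints E.X) (n : ℕ) :
    (n • pullbackPoint f P₀).ell = ell (Finsupp.single P₀ (n : ℤ) : E.Divisor) +
      ell (Finsupp.single P₀ (n : ℤ) + halfDiv d) := by
  have h1 : Function.Injective (decomposition hf δ) := by
    intro p q hpq
    have := hδ.eq_of_add_eq_add hpq
    exact Prod.ext this.1 this.2
  have h2 : (n • pullbackPoint f P₀).riemannRochSpace = Submodule.map (decomposition hf δ)
      (Submodule.prod (riemannRochSpace (Finsupp.single P₀ (n : ℤ) : E.Divisor))
        (riemannRochSpace (Finsupp.single P₀ (n : ℤ) + halfDiv d))) := by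
    ext z
    obtain ⟨a, b, rfl⟩ := hδ.exists_eq z
    have h3 : pullback f a + pullback f b * δ = decomposition hf δ (a, b) := rfl
    rw [mem_riemannRochSpace_pullback hf hE hδ, h3]
    rw [Submodule.mem_map]
    constructor
    · exact fun h => ⟨(a, b), h, rfl⟩
    · rintro ⟨p, hp, hpq⟩
      rwa [h1 hpq] at hp
  have := finiteDimensional_riemannRochSpace hE (Finsupp.single P₀ (n : ℤ) : E.Divisor)
  have := finiteDimensional_riemannRochSpace hE (Finsupp.single P₀ (n : ℤ) + halfDiv d)
  rw [ell, h2, ← (Submodule.equivMapOfInjective _ h1 _).finrank_eq, ell, ell,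
    ← Module.finrank_prod]
  exact LinearEquiv.finrank_eq
    { toFun := fun p => (⟨p.1.1, p.2.1⟩, ⟨p.1.2, p.2.2⟩)
      invFun := fun p => ⟨(p.1.1, p.2.1), p.1.2, p.2.2⟩
      map_add' := fun _ _ => rfl
      map_smul' := fun _ _ => rfl }

omit hE in
/-- The Riemann-Hurwitz count for a double cover of a curve of genus one by a curve of genus two.
Both sides of `ℓ(n f^*P₀) = ℓ(nP₀) + ℓ(nP₀ + ⌊div d / 2⌋)` are polynomials in `n` for large `n`:
`n deg (f^*P₀) - 1` on the left and `2n + deg ⌊div d / 2⌋` on the right. -/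
theorem degree_halfDiv (hE : E.HasGenus 1) (hC : C.HasGenus 2) : (halfDiv d).degree = -1 := by
  obtain ⟨P₀⟩ := E.nonempty_closedPoints
  obtain ⟨N, hN⟩ := exists_forall_ell_eq hC
  let s := (pullbackPoint f P₀).degree
  have hs0 : 0 ≤ s := degree_nonneg (pullbackPoint_nonneg P₀)
  have hE' : ∀ n : ℕ, 1 ≤ n → 1 ≤ n + (halfDiv d).degree →
      ((n • pullbackPoint f P₀).ell : ℤ) = 2 * n + (halfDiv d).degree := by
    intro n hn hn'
    rw [ell_pullback hf hE hδ]
    push_cast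
    rw [ell_eq_degree hE, ell_eq_degree hE, degree_add, degree_single]
    · ring
    · rw [degree_add, degree_single]; omega
    · rw [degree_single]; omega
  -- otherwise `f^* P₀ = 0` and the left side would be `ℓ(0) = 1` for all `n`
  have hs : 1 ≤ s := by
    by_contra hs
    have h0 : pullbackPoint f P₀ = 0 :=
      eq_zero_of_degree_eq_zero (pullbackPoint_nonneg P₀) (by omega)
    have := hE' ((halfDiv d).degree.natAbs + 1) (by omega) (by omega)
    rw [h0, smul_zero, ell_zero hC] at this
    omega
  have hC' : ∀ n : ℕ, N ≤ n → ((n • pullbackPoint f P₀).ell : ℤ) = n * s + 1 - 2 := by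
    intro n hn
    rw [hN, degree_nsmul]
    · rfl
    · rw [degree_nsmul]
      nlinarith
  let n := N.toNat + (halfDiv d).degree.natAbs + 1
  have h1 := (hE' n (by omega) (by omega)).symm.trans (hC' n (by omega))
  have h2 := (hE' (n + 1) (by omega) (by omega)).symm.trans (hC' (n + 1) (by omega))
  push_cast at h2
  have h3 : s = 2 := by linarith
  rw [h3] at h1
  linarith

end

end NonsingularCurve

namespace NonsingularCurve

open Divisor Polynomial

variable {E : NonsingularCurve}

/-! ### Weierstrass equations on a curve of genus one -/

theorem exists_eq_algebraMap_of_mem_single (hE : E.HasGenus 1) {O : closedPoints E.X}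
    {z : E.FunctionField} (hz : z ∈ riemannRochSpace (Finsupp.single O 1 : E.Divisor)) :
    ∃ c : ℂ, z = algebraMap ℂ _ c := by
  have := finiteDimensional_riemannRochSpace hE (Finsupp.single O 1)
  have h : (0 : E.Divisor).riemannRochSpace = riemannRochSpace (Finsupp.single O 1) :=
    Submodule.eq_of_le_of_finrank_eq
      (riemannRochSpace_mono (Finsupp.single_nonneg.mpr zero_le_one))
      ((ell_zero hE).trans (ell_single_one hE O).symm)
  exact exists_eq_algebraMap_of_mem hE (h ▸ hz)

theorem mem_riemannRochSpace_single_iff {O : closedPoints E.X} {z : E.FunctionField} (hz : z ≠ 0)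
    {n : ℤ} : z ∈ riemannRochSpace (Finsupp.single O n : E.Divisor) ↔
      -n ≤ ord O z ∧ ∀ P ≠ O, 0 ≤ ord P z := by
  classical
  rw [mem_riemannRochSpace_iff hz]
  constructor
  · intro h
    refine ⟨by simpa using h O, fun P hP => ?_⟩
    simpa [Finsupp.single_apply, hP.symm] using h P
  · rintro ⟨h1, h2⟩ P
    rcases eq_or_ne P O with rfl | hP
    · simpa using h1
    · simpa [Finsupp.single_apply, hP.symm] using h2 P hP

/-- A function on a curve of genus one does not have a single simple pole. -/
theorem ord_ne_neg_one (hE : E.HasGenus 1) {O : closedPoints E.X} {z : E.FunctionField}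
    (hz : z ≠ 0) (hreg : ∀ P ≠ O, 0 ≤ ord P z) : ord O z ≠ -1 := by
  intro h
  obtain ⟨c, rfl⟩ := exists_eq_algebraMap_of_mem_single hE
    ((mem_riemannRochSpace_single_iff hz).mpr ⟨h.ge, hreg⟩)
  rw [ord_algebraMap] at h
  omega

/-- A function `d` with `deg ⌊div d / 2⌋ = -1` on a curve of genus one can be multiplied by a
square such that it has a double pole at one point `O` and only simple zeros. -/
theorem exists_normalized_mul_sq (hE : E.HasGenus 1) {d : E.FunctionField} (hd : d ≠ 0)
    (hdeg : (halfDiv d).degree = -1) :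
    ∃ (O : closedPoints E.X) (h : E.FunctionField), h ≠ 0 ∧ ord O (d * h ^ 2) = -2 ∧
      (∀ P ≠ O, 0 ≤ ord P (d * h ^ 2) ∧ ord P (d * h ^ 2) ≤ 1) ∧
      ∃ P ≠ O, ord P (d * h ^ 2) = 1 := by
  classical
  -- dividing `d` by `h²` leaves the parities of its orders, less a double pole at `O`
  obtain ⟨h, h0, O, hO⟩ := exists_add_div_eq_single hE (D := -halfDiv d)
    (by rw [degree_neg, hdeg, neg_neg])
  have hdh : d * h⁻¹ ^ 2 ≠ 0 := mul_ne_zero hd (pow_ne_zero 2 (inv_ne_zero h0))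
  have hord : ∀ P, ord P (d * h⁻¹ ^ 2) = ord P d % 2 - if O = P then 2 else 0 := by
    intro P
    have h1 : -(ord P d / 2) + ord P h = if O = P then 1 else 0 := by
      rw [← Finsupp.single_apply, ← hO]
      rfl
    rw [ord_mul hd (pow_ne_zero 2 (inv_ne_zero h0)), ord_pow, ord_inv]
    push_cast
    split_ifs at h1 ⊢ <;> omega
  have hreg : ∀ P ≠ O, 0 ≤ ord P (d * h⁻¹ ^ 2) ∧ ord P (d * h⁻¹ ^ 2) ≤ 1 := by
    intro P hP
    rw [hord, if_neg hP.symm]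
    omega
  -- the order at `O` is `-2` or `-1`, and a single simple pole is impossible
  have hpole : ord O (d * h⁻¹ ^ 2) = -2 := by
    have h1 := ord_ne_neg_one hE hdh fun P hP => (hreg P hP).1
    have h2 := hord O
    rw [if_pos rfl] at h2
    omega
  refine ⟨O, h⁻¹, inv_ne_zero h0, hpole, hreg, ?_⟩
  by_contra! hne
  have h1 : div (d * h⁻¹ ^ 2) = Finsupp.single O (-2) := by
    ext P
    rw [div_apply, Finsupp.single_apply]
    split_ifs with hP
    · rw [← hP, hpole]
    · have := hreg P (Ne.symm hP)
      have := hne P (Ne.symm hP)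
      omega
  have h2 := degree_div hE hdh
  rw [h1, degree_single] at h2
  omega

section

variable {O : closedPoints E.X} {x y : E.FunctionField}

theorem ord_aeval (hxO : ord O x = -2) {p : ℂ[X]} (hp : p ≠ 0) :
    aeval x p ≠ 0 ∧ ord O (aeval x p) = -2 * p.natDegree := by
  have hx0 : x ≠ 0 := by
    rintro rfl
    simp [ord] at hxO
  induction hn : p.natDegree generalizing p with
  | zero =>
    rw [natDegree_eq_zero] at hn
    obtain ⟨c, rfl⟩ := hn
    rw [aeval_C]
    exact ⟨(_root_.map_ne_zero _).mpr (by simpa using hp), by rw [ord_algebraMap]; rfl⟩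
  | succ n ih =>
    have hdeg : p.divX.natDegree = n := by rw [natDegree_divX_eq_natDegree_tsub_one, hn]; rfl
    have hdiv : p.divX ≠ 0 := by
      intro h0
      rw [divX_eq_zero_iff] at h0
      rw [h0, natDegree_C] at hn
      omega
    obtain ⟨h1, h2⟩ := ih hdiv hdeg
    have h3 : ord O (aeval x p.divX * x) = -2 * (n + 1 : ℕ) := by
      rw [ord_mul h1 hx0, h2, hxO]
      push_cast
      ring
    have h4 := ord_add_eq_of_lt (P := O) (mul_ne_zero h1 hx0)
      (g := algebraMap ℂ _ (p.coeff 0)) (fun _ => by rw [h3, ord_algebraMap]; omega)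
    have h5 : aeval x p = aeval x p.divX * x + algebraMap ℂ _ (p.coeff 0) := by
      conv_lhs => rw [← divX_mul_X_add p]
      rw [map_add, map_mul, aeval_X, aeval_C]
    rw [h5]
    exact ⟨h4.1, h4.2.trans h3⟩

/-- The orders at `O` of `p(x)` and `q(x) y` have different parity, so they cannot cancel. -/
theorem ord_aeval_add (hxO : ord O x = -2) (hyO : ord O y = -3) {p q : ℂ[X]}
    (hpq : p ≠ 0 ∨ q ≠ 0) : aeval x p + aeval x q * y ≠ 0 ∧
      (p ≠ 0 → ord O (aeval x p + aeval x q * y) ≤ -2 * p.natDegree) ∧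
      (q ≠ 0 → ord O (aeval x p + aeval x q * y) ≤ -2 * q.natDegree - 3) := by
  have hy0 : y ≠ 0 := by
    rintro rfl
    simp [ord] at hyO
  rcases eq_or_ne p 0 with rfl | hp
  · have hq := hpq.resolve_left (fun h => h rfl)
    obtain ⟨h1, h2⟩ := ord_aeval hxO hq
    rw [map_zero, zero_add]
    exact ⟨mul_ne_zero h1 hy0, fun h => absurd rfl h, fun _ => by
      rw [ord_mul h1 hy0, h2, hyO]; omega⟩
  · obtain ⟨h1, h2⟩ := ord_aeval hxO hp
    rcases eq_or_ne q 0 with rfl | hq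
    · rw [map_zero, zero_mul, add_zero]
      exact ⟨h1, fun _ => h2.le, fun h => absurd rfl h⟩
    · obtain ⟨h3, h4⟩ := ord_aeval hxO hq
      have h5 : ord O (aeval x q * y) = -2 * q.natDegree - 3 := by
        rw [ord_mul h3 hy0, h4, hyO]; ring
      rcases lt_or_ge (-2 * (p.natDegree : ℤ)) (-2 * q.natDegree - 3) with hlt | hge
      · obtain ⟨h6, h7⟩ := ord_add_eq_of_lt (P := O) (g := aeval x q * y) h1
          (fun _ => by rw [h2, h5]; exact hlt)
        exact ⟨h6, fun _ => by omega, fun _ => by omega⟩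
      · obtain ⟨h6, h7⟩ := ord_add_eq_of_lt (P := O) (g := aeval x p) (mul_ne_zero h3 hy0)
          (fun _ => by rw [h2, h5]; omega)
        rw [add_comm]
        exact ⟨h6, fun _ => by omega, fun _ => by omega⟩

theorem eq_zero_of_aeval_add_eq_zero (hxO : ord O x = -2) (hyO : ord O y = -3) {p q : ℂ[X]}
    (h : aeval x p + aeval x q * y = 0) : p = 0 ∧ q = 0 := by
  by_contra hpq
  exact (ord_aeval_add hxO hyO (not_and_or.mp hpq)).1 h

/-- The functions regular away from `O` are the polynomials `p(x) + q(x) y`: the pole orders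
`2i` and `2i + 3` are all natural numbers except `1`, which is no pole order. -/
theorem exists_eq_aeval_add (hE : E.HasGenus 1) (hxO : ord O x = -2)
    (hx : ∀ P ≠ O, 0 ≤ ord P x) (hyO : ord O y = -3) (hy : ∀ P ≠ O, 0 ≤ ord P y)
    {z : E.FunctionField} (hz : ∀ P ≠ O, E.valuation P z ≤ 1) :
    ∃ p q : ℂ[X], z = aeval x p + aeval x q * y := by
  have hx0 : x ≠ 0 := by
    rintro rfl
    simp [ord] at hxO
  have hy0 : y ≠ 0 := by
    rintro rfl
    simp [ord] at hyO
  have hconst : ∀ z : E.FunctionField, (∃ c : ℂ, z = algebraMap ℂ _ c) →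
      ∃ p q : ℂ[X], z = aeval x p + aeval x q * y := by
    rintro _ ⟨c, rfl⟩
    exact ⟨Polynomial.C c, 0, by simp⟩
  have key : ∀ (n : ℕ) (z : E.FunctionField),
      z ∈ riemannRochSpace (Finsupp.single O (n : ℤ) : E.Divisor) →
      ∃ p q : ℂ[X], z = aeval x p + aeval x q * y := by
    intro n
    induction n with
    | zero =>
      intro z hz
      refine hconst z (exists_eq_algebraMap_of_mem hE ?_)
      simpa using hz
    | succ n ih =>
      intro z hz
      rcases Nat.eq_zero_or_pos n with rfl | hn
      · exact hconst z (exists_eq_algebraMap_of_mem_single hE (by simpa using hz))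
      · obtain ⟨p₁, q₁, hm⟩ : ∃ p q : ℂ[X], aeval x p + aeval x q * y ≠ 0 ∧
            ord O (aeval x p + aeval x q * y) = -(n + 1 : ℕ) ∧
            ∀ P ≠ O, 0 ≤ ord P (aeval x p + aeval x q * y) := by
          obtain ⟨m, hm | hm⟩ := Nat.even_or_odd' (n + 1)
          · refine ⟨Polynomial.X ^ m, 0, ?_⟩
            rw [map_zero, zero_mul, add_zero, map_pow, aeval_X, ord_pow, hxO, hm]
            refine ⟨pow_ne_zero _ hx0, by push_cast; ring, fun P hP => ?_⟩
            rw [ord_pow]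
            exact mul_nonneg (Int.natCast_nonneg _) (hx P hP)
          · obtain ⟨k, rfl⟩ : ∃ k, m = k + 1 := ⟨m - 1, by omega⟩
            refine ⟨0, Polynomial.X ^ k, ?_⟩
            rw [map_zero, zero_add, map_pow, aeval_X, ord_mul (pow_ne_zero _ hx0) hy0, ord_pow,
              hxO, hyO, hm]
            refine ⟨mul_ne_zero (pow_ne_zero _ hx0) hy0, by push_cast; ring, fun P hP => ?_⟩
            rw [ord_mul (pow_ne_zero _ hx0) hy0, ord_pow]
            exact add_nonneg (mul_nonneg (Int.natCast_nonneg _) (hx P hP)) (hy P hP)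
        obtain ⟨hm0, hmO, hmreg⟩ := hm
        -- subtract a multiple of the monomial with pole order `n + 1`
        obtain ⟨c, hc⟩ := exists_sub_smul_mem
          ((mem_riemannRochSpace_single_iff hm0).mpr ⟨hmO.ge, hmreg⟩) hm0
          (by rw [hmO, Finsupp.single_eq_same]) hz
        rw [← Finsupp.single_sub] at hc
        obtain ⟨p, q, hpq⟩ := ih _ (by simpa using hc)
        refine ⟨p + Polynomial.C c * p₁, q + Polynomial.C c * q₁, ?_⟩
        rw [sub_eq_iff_eq_add] at hpq
        rw [hpq]
        simp only [Algebra.smul_def, map_add, map_mul, aeval_C]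
        ring
  rcases eq_or_ne z 0 with rfl | hz0
  · exact ⟨0, 0, by simp⟩
  · refine key (-ord O z).toNat z ((mem_riemannRochSpace_single_iff hz0).mpr
      ⟨by omega, fun P hP => (valuation_le_one_iff_ord hz0).mp (hz P hP)⟩)

theorem valuation_aeval_le_one {P : closedPoints E.X} (hx : 0 ≤ ord P x) (p : ℂ[X]) :
    E.valuation P (aeval x p) ≤ 1 := by
  have hx' : E.valuation P x ≤ 1 := by
    rcases eq_or_ne x 0 with rfl | h0
    · simp
    · exact (valuation_le_one_iff_ord h0).mpr hx
  induction p using Polynomial.induction_on' with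
  | add p q hp hq =>
    rw [map_add]
    exact (E.valuation P).map_add_le hp hq
  | monomial n c =>
    rw [aeval_monomial, map_mul, map_pow]
    exact mul_le_one' (E.valuation_const_le_one P c) (pow_le_one' hx' n)

/-- The Weierstrass equation, after completing the square: for a function `y` of pole order three,
`y²` is of the form `p(x) + q(x) y`. -/
theorem exists_sq_eq_aeval (hE : E.HasGenus 1) (hxO : ord O x = -2)
    (hx : ∀ P ≠ O, 0 ≤ ord P x) :
    ∃ (y : E.FunctionField) (c : ℂ[X]), ord O y = -3 ∧ (∀ P ≠ O, 0 ≤ ord P y) ∧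
      c.natDegree = 3 ∧ y ^ 2 = aeval x c := by
  obtain ⟨y, hy, hy0, hyO⟩ := exists_ord_eq_neg_of_ell_lt (D := Finsupp.single O (3 : ℤ)) (P := O)
    (by
      rw [← Finsupp.single_sub]
      have h1 := ell_eq_degree hE (D := Finsupp.single O (3 : ℤ)) (by rw [degree_single]; omega)
      have h2 := ell_eq_degree hE (D := Finsupp.single O (3 - 1 : ℤ)) (by rw [degree_single]; omega)
      rw [degree_single] at h1 h2
      omega)
  rw [Finsupp.single_eq_same] at hyO
  have hyreg := ((mem_riemannRochSpace_single_iff hy0).mp hy).2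
  obtain ⟨p, q, hpq⟩ := exists_eq_aeval_add hE hxO hx hyO hyreg (z := y ^ 2) fun P hP => by
    rw [map_pow]
    exact pow_le_one' ((valuation_le_one_iff_ord hy0).mpr (hyreg P hP)) 2
  have hysq : ord O (y ^ 2) = -6 := by rw [ord_pow, hyO]; rfl
  have hq : q ≠ 0 → q.natDegree ≤ 1 := by
    intro hq
    have := (ord_aeval_add hxO hyO (p := p) (Or.inr hq)).2.2 hq
    rw [← hpq, hysq] at this
    omega
  have h2 : ((algebraMap ℂ E.FunctionField) (1 / 2)) * 2 = 1 := by
    rw [map_div₀, map_one, map_ofNat]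
    norm_num
  let y₁ := y + -(aeval x (Polynomial.C (1 / 2) * q))
  have hy₁ : y₁ ≠ 0 ∧ ord O y₁ = ord O y := by
    refine ord_add_eq_of_lt hy0 fun h0 => ?_
    have hq0 : Polynomial.C (1 / 2) * q ≠ 0 := by
      intro h
      rw [h, map_zero, neg_zero] at h0
      exact h0 rfl
    have hq1 := hq (right_ne_zero_of_mul hq0)
    rw [ord_neg, (ord_aeval hxO hq0).2, hyO, natDegree_C_mul (by norm_num)]
    omega
  have hsq : y₁ ^ 2 = aeval x (p + (Polynomial.C (1 / 2) * q) ^ 2) := by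
    simp only [y₁, map_add, map_pow, map_mul, aeval_C]
    linear_combination hpq - (aeval x q * y) * h2
  refine ⟨y₁, p + (Polynomial.C (1 / 2) * q) ^ 2, hy₁.2.trans hyO, fun P hP => ?_, ?_, hsq⟩
  · rw [← valuation_le_one_iff_ord hy₁.1]
    refine (E.valuation P).map_add_le ((valuation_le_one_iff_ord hy0).mpr (hyreg P hP)) ?_
    rw [Valuation.map_neg]
    exact valuation_aeval_le_one (hx P hP) _
  · have hc0 : p + (Polynomial.C (1 / 2) * q) ^ 2 ≠ 0 := by
      intro h0
      rw [h0, map_zero] at hsq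
      exact hy₁.1 (pow_eq_zero_iff two_ne_zero |>.mp hsq)
    have h3 := (ord_aeval hxO hc0).2
    rw [← hsq, ord_pow, hy₁.2, hyO] at h3
    push_cast at h3
    omega

end

end NonsingularCurve

/-! ### The Legendre form -/

namespace NonsingularCurve

open Divisor Polynomial

variable {E : NonsingularCurve}

section

variable {O : closedPoints E.X} {x y : E.FunctionField}

theorem sub_const_ne_zero_and_ord (hxO : ord O x = -2) (c : ℂ) :
    x - algebraMap ℂ _ c ≠ 0 ∧ ord O (x - algebraMap ℂ _ c) = -2 := by
  have h := ord_aeval hxO (X_sub_C_ne_zero c)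
  simp only [map_sub, aeval_X, aeval_C, natDegree_X_sub_C] at h
  exact ⟨h.1, by rw [h.2]; rfl⟩

theorem ord_sub_const_nonneg {P : closedPoints E.X} (hx : 0 ≤ ord P x) {c : ℂ}
    (h0 : x - algebraMap ℂ _ c ≠ 0) : 0 ≤ ord P (x - algebraMap ℂ _ c) := by
  rw [← valuation_le_one_iff_ord h0]
  have h := valuation_aeval_le_one hx (Polynomial.X - Polynomial.C c)
  rwa [map_sub, aeval_X, aeval_C] at h

/-- If the cubic had a double root `e`, then `y / (x - e)` would have a single simple pole. -/
theorem sq_ne_of_double_root (hE : E.HasGenus 1) (hxO : ord O x = -2)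
    (hx : ∀ P ≠ O, 0 ≤ ord P x) (hyO : ord O y = -3) (a e e' : ℂ) :
    y ^ 2 ≠ algebraMap ℂ _ a * (x - algebraMap ℂ _ e) ^ 2 * (x - algebraMap ℂ _ e') := by
  intro h
  have hy0 : y ≠ 0 := by
    rintro rfl
    simp [ord] at hyO
  have ha : algebraMap ℂ E.FunctionField a ≠ 0 := by
    intro ha
    rw [ha, zero_mul, zero_mul] at h
    exact hy0 (pow_eq_zero_iff two_ne_zero |>.mp h)
  obtain ⟨h1, h2⟩ := sub_const_ne_zero_and_ord hxO e
  obtain ⟨h3, h4⟩ := sub_const_ne_zero_and_ord hxO e'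
  have hw : y * (x - algebraMap ℂ _ e)⁻¹ ≠ 0 := mul_ne_zero hy0 (inv_ne_zero h1)
  have hsq : (y * (x - algebraMap ℂ _ e)⁻¹) ^ 2 =
      algebraMap ℂ _ a * (x - algebraMap ℂ _ e') := by
    rw [mul_pow, h]
    field_simp
  refine ord_ne_neg_one hE (O := O) hw (fun P hP => ?_) ?_
  · have h5 := congrArg (ord P) hsq
    rw [ord_pow, ord_mul ha h3, ord_algebraMap] at h5
    have := ord_sub_const_nonneg (hx P hP) h3
    push_cast at h5
    omega
  · rw [ord_mul hy0 (inv_ne_zero h1), ord_inv, hyO, h2]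
    rfl

/-- If `x` has a simple zero, then `0` is not a root of the cubic, since otherwise `y` would
vanish to a half-integral order there. -/
theorem sq_ne_of_root_zero {P : closedPoints E.X} (hxO : ord O x = -2) (hxP : ord P x = 1)
    {a e e' : ℂ} (ha : a ≠ 0) (he : e ≠ 0) (he' : e' ≠ 0) :
    y ^ 2 ≠ algebraMap ℂ _ a * x * (x - algebraMap ℂ _ e) * (x - algebraMap ℂ _ e') := by
  intro h
  have hx0 : x ≠ 0 := by
    rintro rfl
    simp [ord] at hxO
  have hunit : ∀ e : ℂ, e ≠ 0 → ord P (x - algebraMap ℂ _ e) = 0 := by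
    intro e he
    have he1 : algebraMap ℂ E.FunctionField (-e) ≠ 0 :=
      (_root_.map_ne_zero _).mpr (neg_ne_zero.mpr he)
    have := (ord_add_eq_of_lt (P := P) (g := x) he1
      (fun _ => by rw [ord_algebraMap, hxP]; omega)).2
    rwa [ord_algebraMap, map_neg, neg_add_eq_sub] at this
  obtain ⟨h1, -⟩ := sub_const_ne_zero_and_ord hxO e
  obtain ⟨h3, -⟩ := sub_const_ne_zero_and_ord hxO e'
  have ha' : algebraMap ℂ E.FunctionField a ≠ 0 := (_root_.map_ne_zero _).mpr ha
  have h5 := congrArg (ord P) h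
  rw [ord_pow, ord_mul (mul_ne_zero (mul_ne_zero ha' hx0) h1) h3,
    ord_mul (mul_ne_zero ha' hx0) h1, ord_mul ha' hx0, ord_algebraMap, hunit e he, hunit e' he',
    hxP] at h5
  push_cast at h5
  omega

end

/-- The Legendre form of a curve of genus one, adapted to a function `d` with a double pole at
`O` and a simple zero: `d` is a multiple of `t' - x`. -/
theorem exists_legendre (hE : E.HasGenus 1) {O : closedPoints E.X} {d : E.FunctionField}
    (hdO : ord O d = -2) (hd : ∀ P ≠ O, 0 ≤ ord P d) {P : closedPoints E.X} (hdP : ord P d = 1) :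
    ∃ (t t' κ : ℂ) (x y : E.FunctionField), t ≠ 0 ∧ t ≠ 1 ∧ t' ≠ 0 ∧ t' ≠ 1 ∧ t ≠ t' ∧ κ ≠ 0 ∧
      ord O x = -2 ∧ (∀ P ≠ O, 0 ≤ ord P x) ∧ ord O y = -3 ∧ (∀ P ≠ O, 0 ≤ ord P y) ∧
      y ^ 2 = x * (x - 1) * (x - algebraMap ℂ _ t) ∧
      algebraMap ℂ _ t' - x = d * algebraMap ℂ _ κ ^ 2 := by
  obtain ⟨y, c, hyO, hy, hc, hyc⟩ := exists_sq_eq_aeval hE hdO hd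
  have hy0 : y ≠ 0 := by
    rintro rfl
    simp [ord] at hyO
  have hsplit := IsAlgClosed.splits c
  obtain ⟨e₁, e₂, e₃, hroots⟩ := Multiset.card_eq_three.mp
    (hsplit.natDegree_eq_card_roots.symm.trans hc)
  have hc0 : c ≠ 0 := by
    rintro rfl
    simp at hc
  have ha : c.leadingCoeff ≠ 0 := leadingCoeff_ne_zero.mpr hc0
  have hfac : c = Polynomial.C c.leadingCoeff *
      ((Polynomial.X - Polynomial.C e₁) * (Polynomial.X - Polynomial.C e₂) *
        (Polynomial.X - Polynomial.C e₃)) := by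
    have := hsplit.eq_prod_roots
    rw [hroots] at this
    simpa [mul_assoc] using this
  set a := c.leadingCoeff
  have hyeq : y ^ 2 = algebraMap ℂ _ a * (d - algebraMap ℂ _ e₁) * (d - algebraMap ℂ _ e₂) *
      (d - algebraMap ℂ _ e₃) := by
    rw [hyc, hfac]
    simp only [map_mul, map_sub, aeval_C, aeval_X]
    ring
  have h12 : e₁ ≠ e₂ := by
    rintro rfl
    exact sq_ne_of_double_root hE hdO hd hyO a e₁ e₃ (by rw [hyeq]; ring)
  have h13 : e₁ ≠ e₃ := by
    rintro rfl
    exact sq_ne_of_double_root hE hdO hd hyO a e₁ e₂ (by rw [hyeq]; ring)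
  have h23 : e₂ ≠ e₃ := by
    rintro rfl
    exact sq_ne_of_double_root hE hdO hd hyO a e₂ e₁ (by rw [hyeq]; ring)
  have h1 : e₁ ≠ 0 := by
    rintro rfl
    exact sq_ne_of_root_zero hdO hdP ha h12.symm h13.symm (by rw [hyeq, map_zero]; ring)
  have h2 : e₂ ≠ 0 := by
    rintro rfl
    exact sq_ne_of_root_zero hdO hdP ha h12 h23.symm (by rw [hyeq, map_zero]; ring)
  have h3 : e₃ ≠ 0 := by
    rintro rfl
    exact sq_ne_of_root_zero hdO hdP ha h13 h23 (by rw [hyeq, map_zero]; ring)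
  have hs : e₂ - e₁ ≠ 0 := sub_ne_zero.mpr h12.symm
  -- the substitution `x = (d - e₁) / (e₂ - e₁)` moves two of the roots to `0` and `1`; then
  -- `t' - x = -d / (e₂ - e₁)`, and `μ` rescales `y` so that the cubic becomes monic
  obtain ⟨κ, hκ⟩ := IsAlgClosed.exists_pow_nat_eq (-(e₂ - e₁)⁻¹) two_pos
  obtain ⟨μ, hμ⟩ := IsAlgClosed.exists_pow_nat_eq (a * (e₂ - e₁) ^ 3)⁻¹ two_pos
  have hκ0 : κ ≠ 0 := by
    rintro rfl
    rw [zero_pow two_ne_zero, eq_comm, neg_eq_zero, inv_eq_zero] at hκ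
    exact hs hκ
  have hμ0 : μ ≠ 0 := by
    rintro rfl
    rw [zero_pow two_ne_zero, eq_comm, inv_eq_zero] at hμ
    exact mul_ne_zero ha (pow_ne_zero 3 hs) hμ
  have hμ' : algebraMap ℂ E.FunctionField μ ≠ 0 := (_root_.map_ne_zero _).mpr hμ0
  have hs' : algebraMap ℂ E.FunctionField (e₂ - e₁)⁻¹ ≠ 0 :=
    (_root_.map_ne_zero _).mpr (inv_ne_zero hs)
  obtain ⟨hne, hord⟩ := sub_const_ne_zero_and_ord hdO e₁
  refine ⟨(e₃ - e₁) / (e₂ - e₁), -e₁ / (e₂ - e₁), κ,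
    algebraMap ℂ _ (e₂ - e₁)⁻¹ * (d - algebraMap ℂ _ e₁), algebraMap ℂ _ μ * y,
    ?_, ?_, ?_, ?_, ?_, hκ0, ?_, ?_, ?_, ?_, ?_, ?_⟩
  · exact div_ne_zero (sub_ne_zero.mpr h13.symm) hs
  · rw [Ne, div_eq_one_iff_eq hs, sub_left_inj]
    exact h23.symm
  · exact div_ne_zero (neg_ne_zero.mpr h1) hs
  · rw [Ne, div_eq_one_iff_eq hs]
    intro h
    exact h2 (by linear_combination -h)
  · intro h
    rw [div_left_inj' hs] at h
    exact h3 (by linear_combination h)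
  · rw [ord_mul hs' hne, ord_algebraMap, hord, zero_add]
  · intro P hP
    rw [ord_mul hs' hne, ord_algebraMap, zero_add]
    exact ord_sub_const_nonneg (hd P hP) hne
  · rw [ord_mul hμ' hy0, ord_algebraMap, hyO, zero_add]
  · intro P hP
    rw [ord_mul hμ' hy0, ord_algebraMap, zero_add]
    exact hy P hP
  · have hsE : algebraMap ℂ E.FunctionField e₂ - algebraMap ℂ E.FunctionField e₁ ≠ 0 := by
      rw [← map_sub]
      exact (_root_.map_ne_zero _).mpr hs
    have haE : algebraMap ℂ E.FunctionField a ≠ 0 := (_root_.map_ne_zero _).mpr ha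
    rw [mul_pow, ← map_pow, hμ, hyeq]
    simp only [map_inv₀, map_div₀, map_sub, map_mul, map_pow]
    field_simp
    ring
  · rw [← map_pow, hκ]
    simp only [map_inv₀, map_div₀, map_sub, map_neg]
    ring

end NonsingularCurve

/-! ### Coordinate rings -/

namespace DoubleCoverRing

open Polynomial

theorem exists_eq_aeval_add_mul_y (F : ℂ[X]) (r : DoubleCoverRing F) :
    ∃ p q : ℂ[X], r = aeval (u F) p + aeval (u F) q * y F := by
  obtain ⟨g, rfl⟩ := AdjoinRoot.mk_surjective r
  have hmonic : (Polynomial.X ^ 2 - Polynomial.C F : ℂ[X][X]).Monic :=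
    monic_X_pow_sub_C F two_ne_zero
  have hdeg : (g %ₘ (Polynomial.X ^ 2 - Polynomial.C F)).natDegree ≤ 1 := by
    have := natDegree_modByMonic_lt g hmonic (fun h => by
      have := congrArg natDegree h
      rw [natDegree_X_pow_sub_C, natDegree_one] at this
      omega)
    rw [natDegree_X_pow_sub_C] at this
    omega
  obtain ⟨q, p, hqp⟩ := exists_eq_X_add_C_of_natDegree_le_one hdeg
  refine ⟨p, q, ?_⟩
  have hg := modByMonic_add_div g (Polynomial.X ^ 2 - Polynomial.C F)
  rw [← hg, map_add, map_mul, AdjoinRoot.mk_self, zero_mul, add_zero, hqp, aeval_u, aeval_u,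
    map_add, map_mul, AdjoinRoot.mk_X, AdjoinRoot.mk_C, AdjoinRoot.mk_C, add_comm]
  rfl

/-- The homomorphism `u ↦ x`, `y ↦ w` to a `ℂ`-algebra in which `w² = F(x)`. -/
def liftHom {F : ℂ[X]} {R : Type} [CommRing R] [Algebra ℂ R] (x w : R)
    (h : w ^ 2 = Polynomial.aeval x F) : DoubleCoverRing F →+* R :=
  AdjoinRoot.lift (Polynomial.aeval x : ℂ[X] →ₐ[ℂ] R).toRingHom w (by
    rw [Polynomial.eval₂_sub, Polynomial.eval₂_pow, Polynomial.eval₂_X, Polynomial.eval₂_C, h]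
    exact sub_self _)

section

variable {F : ℂ[X]} {R : Type} [CommRing R] [Algebra ℂ R] {x w : R} (h : w ^ 2 = aeval x F)

theorem liftHom_y : liftHom x w h (y F) = w := by
  simp [liftHom, y]

theorem liftHom_aeval_u (p : ℂ[X]) : liftHom x w h (aeval (u F) p) = aeval x p := by
  rw [aeval_u, liftHom, AdjoinRoot.lift_of]
  rfl

theorem liftHom_u : liftHom x w h (u F) = x := by
  simpa using liftHom_aeval_u h X

theorem liftHom_algebraMap (c : ℂ) :
    liftHom x w h (algebraMap ℂ _ c) = algebraMap ℂ R c := by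
  simpa using liftHom_aeval_u h (Polynomial.C c)

end

/-- The coordinate ring of the double cover is generated as a module over that of the Legendre
curve by `1` and `ξ`. -/
theorem exists_eq_biellipticCoverRingHom_add (t t' : ℂ)
    (r : DoubleCoverRing (biellipticSextic t t')) :
    ∃ b₀ b₁, r = biellipticCoverRingHom t t' b₀ + biellipticCoverRingHom t t' b₁ * u _ := by
  have hc : ∀ c, biellipticCoverRingHom t t' (algebraMap ℂ _ c) = algebraMap ℂ _ c :=
    liftHom_algebraMap (by rw [DoubleCoverRing.y_sq, aeval_biellipticSextic])
  have hu : u (biellipticSextic t t') * u (biellipticSextic t t') = biellipticCoverRingHom t t'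
      (algebraMap ℂ _ t' - u (legendreCubic t)) := by
    rw [map_sub, biellipticCoverRingHom_u, hc]
    ring
  have hp : ∀ p : ℂ[X], ∃ b₀ b₁, aeval (u (biellipticSextic t t')) p =
      biellipticCoverRingHom t t' b₀ + biellipticCoverRingHom t t' b₁ * u _ := by
    intro p
    induction p using Polynomial.induction_on with
    | C a => exact ⟨algebraMap ℂ _ a, 0, by rw [hc, aeval_C, map_zero, zero_mul, add_zero]⟩
    | add p q hp hq =>
      obtain ⟨b₀, b₁, h⟩ := hp
      obtain ⟨c₀, c₁, h'⟩ := hq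
      refine ⟨b₀ + c₀, b₁ + c₁, ?_⟩
      rw [map_add, h, h', map_add, map_add]
      ring
    | monomial n a h =>
      obtain ⟨b₀, b₁, h⟩ := h
      refine ⟨b₁ * (algebraMap ℂ _ t' - u (legendreCubic t)), b₀, ?_⟩
      have h2 : aeval (u (biellipticSextic t t')) (Polynomial.C a * Polynomial.X ^ (n + 1)) =
          aeval (u (biellipticSextic t t')) (Polynomial.C a * Polynomial.X ^ n) * u _ := by
        simp only [map_mul, map_pow, aeval_X, pow_succ, mul_assoc]
      rw [h2, h, map_mul, ← hu]
      ring
  obtain ⟨p, q, rfl⟩ := exists_eq_aeval_add_mul_y _ r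
  obtain ⟨b₀, b₁, h⟩ := hp p
  obtain ⟨c₀, c₁, h'⟩ := hp q
  refine ⟨b₀ + c₀ * y _, b₁ + c₁ * y _, ?_⟩
  rw [h, h', map_add, map_add, map_mul, map_mul, biellipticCoverRingHom_y]
  ring

end DoubleCoverRing

/-- Rings embedded in a third ring with the same image are isomorphic. -/
theorem exists_ringEquiv_of_range_eq {A B K : Type*} [Ring A] [Ring B] [Ring K] {g : A →+* K}
    {β : B →+* K} (hg : Function.Injective g) (hβ : Function.Injective β)
    (h : ∀ z, (∃ a, g a = z) ↔ ∃ b, β b = z) : ∃ e : B ≃+* A, ∀ b, g (e b) = β b := by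
  choose e he using fun b => (h (β b)).mpr ⟨b, rfl⟩
  let ψ : B →+* A :=
    { toFun := e
      map_one' := hg (by rw [he, map_one, map_one])
      map_mul' := fun a b => hg (by rw [he, map_mul, map_mul, he, he])
      map_zero' := hg (by rw [he, map_zero, map_zero])
      map_add' := fun a b => hg (by rw [he, map_add, map_add, he, he]) }
  have hψ : ∀ b, g (ψ b) = β b := he
  refine ⟨RingEquiv.ofBijective ψ ⟨fun a b hab => ?_, fun a => ?_⟩, hψ⟩
  · apply hβ
    rw [← hψ, ← hψ, hab]
  · obtain ⟨b, hb⟩ := (h (g a)).mp ⟨a, rfl⟩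
    exact ⟨b, hg ((hψ b).trans hb)⟩

namespace NonsingularCurve

open DoubleCoverRing

/-! ### Affine models -/

section

variable {C : NonsingularCurve} {U : C.X.Opens} (hU : IsAffineOpen U) {R : Type} [CommRing R]
  (e : R ≃+* Γ(C.X, U))

/-- The open immersion `Spec R → C` with image `U` for an isomorphism `R ≅ Γ(U)`. -/
def affineModel : Spec (.of R) ⟶ C.X :=
  Spec.map e.symm.toCommRingCatIso.hom ≫ hU.fromSpec

instance : IsOpenImmersion (affineModel hU e) := by
  unfold affineModel
  infer_instance

theorem affineModel_comp_π [Nonempty U] [Algebra ℂ R]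
    (he : ∀ c, C.X.germToFunctionField U (e (algebraMap ℂ R c)) = algebraMap ℂ _ c) :
    affineModel hU e ≫ C.π = Spec.map (CommRingCat.ofHom (algebraMap ℂ R)) := by
  have h1 : (isAffineOpen_top (Spec (.of ℂ))).fromSpec =
      Spec.map (Scheme.ΓSpecIso (.of ℂ)).inv := by
    rw [IsAffineOpen.fromSpec_top, Scheme.isoSpec_Spec_inv]
  have h2 := (isAffineOpen_top (Spec (.of ℂ))).SpecMap_appLE_fromSpec C.π hU le_top
  rw [affineModel, Category.assoc, ← h2, h1, ← Spec.map_comp, ← Spec.map_comp]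
  congr 1
  ext c
  apply e.injective
  apply C.X.germToFunctionField_injective U
  rw [CommRingCat.ofHom]
  refine Eq.trans ?_ (he c).symm
  change C.X.germToFunctionField U (e (e.symm _)) = _
  rw [e.apply_symm_apply]
  exact C.X.presheaf.germ_res_apply _ _ _ _

/-- A morphism is given between affine models by the homomorphism of coordinate rings which induces
the pullback of rational functions. -/
theorem affineModel_comp {E : NonsingularCurve} {f : C.X ⟶ E.X} [IsDominant f] {W : E.X.Opens}
    (hW : IsAffineOpen W) [Nonempty W] [Nonempty (f ⁻¹ᵁ W)] (hV : IsAffineOpen (f ⁻¹ᵁ W))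
    {B : Type} [CommRing B] (eB : B ≃+* Γ(E.X, W)) (eA : R ≃+* Γ(C.X, f ⁻¹ᵁ W)) (ι : B →+* R)
    (h : ∀ b, C.X.germToFunctionField _ (eA (ι b)) =
      pullback f (E.X.germToFunctionField W (eB b))) :
    affineModel hV eA ≫ f = Spec.map (CommRingCat.ofHom ι) ≫ affineModel hW eB := by
  have h1 : f.app W ≫ eA.symm.toCommRingCatIso.hom =
      eB.symm.toCommRingCatIso.hom ≫ CommRingCat.ofHom ι := by
    ext s
    obtain ⟨b, rfl⟩ := eB.surjective s
    have h2 : f.app W (eB b) = eA (ι b) :=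
      C.X.germToFunctionField_injective _ (by rw [h, ← pullback_germToFunctionField])
    change eA.symm (f.app W (eB b)) = ι (eB.symm (eB b))
    rw [h2, eA.symm_apply_apply, eB.symm_apply_apply]
  have h3 := hW.SpecMap_appLE_fromSpec f hV le_rfl
  rw [← Scheme.Hom.app_eq_appLE] at h3
  rw [affineModel, affineModel, Category.assoc, ← h3, ← Spec.map_comp_assoc, h1,
    Spec.map_comp_assoc]

end

end NonsingularCurve

/-! ### Coordinate rings as rings of regular functions -/

namespace NonsingularCurve

open DoubleCoverRing

/-- The sections over `U` are the rational functions regular at the closed points of `U`. -/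
theorem exists_section_iff {C : NonsingularCurve} (U : C.X.Opens) [Nonempty U]
    (z : C.FunctionField) : (∃ s, C.X.germToFunctionField U s = z) ↔
      ∀ P : closedPoints C.X, P.1 ∈ U → C.valuation P z ≤ 1 :=
  ⟨by rintro ⟨s, rfl⟩ P hP; exact valuation_le_one_of_mem s hP,
    exists_section_of_valuation_le_one U⟩

variable {C E : NonsingularCurve} {f : C.X ⟶ E.X} {O : closedPoints E.X} {t t' : ℂ}
  {x y : E.FunctionField} {ξ : C.FunctionField}

section

theorem liftHom_legendre_injective (h : y ^ 2 = Polynomial.aeval x (legendreCubic t))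
    (hxO : ord O x = -2) (hyO : ord O y = -3) : Function.Injective (liftHom x y h) := by
  rw [injective_iff_map_eq_zero]
  intro r hr
  obtain ⟨p, q, rfl⟩ := exists_eq_aeval_add_mul_y _ r
  rw [map_add, map_mul, liftHom_aeval_u, liftHom_aeval_u, liftHom_y] at hr
  obtain ⟨rfl, rfl⟩ := eq_zero_of_aeval_add_eq_zero hxO hyO hr
  simp

/-- The affine coordinate ring of the Legendre curve is the ring of functions on `E` regular away
from `O`. -/
theorem exists_legendre_ringEquiv (hE : E.HasGenus 1)
    (h : y ^ 2 = Polynomial.aeval x (legendreCubic t)) (hxO : ord O x = -2)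
    (hx : ∀ P ≠ O, 0 ≤ ord P x) (hyO : ord O y = -3) (hy : ∀ P ≠ O, 0 ≤ ord P y)
    [Nonempty (complement O)] :
    ∃ e : DoubleCoverRing (legendreCubic t) ≃+* Γ(E.X, complement O),
      ∀ b, E.X.germToFunctionField _ (e b) = liftHom x y h b := by
  refine exists_ringEquiv_of_range_eq (g := (E.X.germToFunctionField _).hom)
    (E.X.germToFunctionField_injective _) (liftHom_legendre_injective h hxO hyO) fun z => ?_
  refine (exists_section_iff _ z).trans ⟨fun hz => ?_, ?_⟩
  · obtain ⟨p, q, rfl⟩ := exists_eq_aeval_add hE hxO hx hyO hy (z := z)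
      fun P hP => hz P fun h => hP (Subtype.ext h)
    refine ⟨Polynomial.aeval (u _) p + Polynomial.aeval (u _) q * DoubleCoverRing.y _, ?_⟩
    rw [map_add, map_mul, liftHom_aeval_u, liftHom_aeval_u, liftHom_y]
  · rintro ⟨r, rfl⟩ P hP
    have hPO : P ≠ O := fun h => hP (congrArg Subtype.val h)
    obtain ⟨p, q, rfl⟩ := exists_eq_aeval_add_mul_y _ r
    rw [map_add, map_mul, liftHom_aeval_u, liftHom_aeval_u, liftHom_y]
    refine (E.valuation P).map_add_le (valuation_aeval_le_one (hx P hPO) p) ?_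
    rw [map_mul]
    refine mul_le_one' (valuation_aeval_le_one (hx P hPO) q) ?_
    simpa using valuation_aeval_le_one (hy P hPO) Polynomial.X

variable [IsDominant f]

theorem sq_eq_aeval_biellipticSextic (hf : f ≫ E.π = C.π)
    (h : y ^ 2 = Polynomial.aeval x (legendreCubic t))
    (hξ : IsSqrtGenerator (pullback f) (algebraMap ℂ _ t' - x) ξ) :
    pullback f y ^ 2 = Polynomial.aeval ξ (biellipticSextic t t') := by
  rw [aeval_biellipticSextic, hξ.sq, map_sub, pullback_const f hf, sub_sub_cancel, ← map_pow, h]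
  simp only [legendreCubic, map_mul, map_sub, Polynomial.aeval_X, Polynomial.aeval_C, map_one,
    pullback_const f hf]

/-- The inclusion of coordinate rings given by `(ξ, y) ↦ (t' - ξ², y)` is the pullback of functions
along `f`. -/
theorem liftHom_biellipticCoverRingHom (hf : f ≫ E.π = C.π)
    (h : y ^ 2 = Polynomial.aeval x (legendreCubic t))
    (hξ : IsSqrtGenerator (pullback f) (algebraMap ℂ _ t' - x) ξ)
    (b : DoubleCoverRing (legendreCubic t)) :
    liftHom ξ (pullback f y) (sq_eq_aeval_biellipticSextic hf h hξ)
        (biellipticCoverRingHom t t' b) =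
      pullback f (liftHom x y h b) := by
  have hc : ∀ c, biellipticCoverRingHom t t' (algebraMap ℂ _ c) = algebraMap ℂ _ c :=
    liftHom_algebraMap (by rw [DoubleCoverRing.y_sq, aeval_biellipticSextic])
  have hp : ∀ p : ℂ[X], liftHom ξ (pullback f y) (sq_eq_aeval_biellipticSextic hf h hξ)
      (biellipticCoverRingHom t t' (Polynomial.aeval (u _) p)) =
        pullback f (Polynomial.aeval x p) := by
    intro p
    induction p using Polynomial.induction_on with
    | C a =>
      rw [Polynomial.aeval_C, Polynomial.aeval_C, hc, liftHom_algebraMap, pullback_const f hf]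
    | add p q hp hq => simp only [map_add, hp, hq]
    | monomial n a _ =>
      simp only [map_mul, map_pow, Polynomial.aeval_C, Polynomial.aeval_X, hc,
        biellipticCoverRingHom_u, map_sub, liftHom_algebraMap, liftHom_u, hξ.sq,
        pullback_const f hf, sub_sub_cancel]
  obtain ⟨p, q, rfl⟩ := exists_eq_aeval_add_mul_y _ b
  simp only [map_add, map_mul, hp, biellipticCoverRingHom_y, liftHom_y, liftHom_aeval_u]

/-- The affine coordinate ring of the double cover is the ring of functions on `C` regular away from
the points over `O`. As `t' - x` has at most simple zeros away from `O`, a function `a + b ξ` is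
regular there iff `a` and `b` are. -/
theorem exists_bielliptic_ringEquiv [IsProper f] (hf : f ≫ E.π = C.π) (hE : E.HasGenus 1)
    (h : y ^ 2 = Polynomial.aeval x (legendreCubic t)) (hxO : ord O x = -2) (hyO : ord O y = -3)
    (hξ : IsSqrtGenerator (pullback f) (algebraMap ℂ _ t' - x) ξ)
    (hd : ∀ P ≠ O, 0 ≤ ord P (algebraMap ℂ _ t' - x) ∧ ord P (algebraMap ℂ _ t' - x) ≤ 1)
    [Nonempty (complement O)] [Nonempty (f ⁻¹ᵁ complement O)]
    (e : DoubleCoverRing (legendreCubic t) ≃+* Γ(E.X, complement O))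
    (he : ∀ b, E.X.germToFunctionField _ (e b) = liftHom x y h b) :
    ∃ e : DoubleCoverRing (biellipticSextic t t') ≃+* Γ(C.X, f ⁻¹ᵁ complement O),
      ∀ b, C.X.germToFunctionField _ (e b) =
        liftHom ξ (pullback f y) (sq_eq_aeval_biellipticSextic hf h hξ) b := by
  have hlift : ∀ b₀ b₁, liftHom ξ (pullback f y) (sq_eq_aeval_biellipticSextic hf h hξ)
      (biellipticCoverRingHom t t' b₀ + biellipticCoverRingHom t t' b₁ * u _) =
      pullback f (liftHom x y h b₀) + pullback f (liftHom x y h b₁) * ξ := fun b₀ b₁ => by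
    rw [map_add, map_mul, liftHom_biellipticCoverRingHom hf h hξ,
      liftHom_biellipticCoverRingHom hf h hξ, liftHom_u]
  refine exists_ringEquiv_of_range_eq (g := (C.X.germToFunctionField _).hom)
    (C.X.germToFunctionField_injective _) ?_ fun z => ?_
  · rw [injective_iff_map_eq_zero]
    intro r hr
    obtain ⟨b₀, b₁, rfl⟩ := exists_eq_biellipticCoverRingHom_add t t' r
    rw [hlift] at hr
    obtain ⟨h0, h1⟩ := hξ.eq_zero_of_add_eq_zero hr
    have hinj := liftHom_legendre_injective h hxO hyO
    rw [(map_eq_zero_iff _ hinj).mp h0, (map_eq_zero_iff _ hinj).mp h1]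
    simp
  · refine (exists_section_iff _ z).trans ?_
    obtain ⟨a, b, rfl⟩ := hξ.exists_eq z
    have h1 : (∀ Q : closedPoints C.X, Q.1 ∈ f ⁻¹ᵁ complement O →
        C.valuation Q (pullback f a + pullback f b * ξ) ≤ 1) ↔
        ∀ P ≠ O, ∀ Q, mapClosedPoint f Q = P →
          C.valuation Q (pullback f a + pullback f b * ξ) ≤ 1 :=
      ⟨fun h P hP Q hQ => h Q fun h' => hP (hQ ▸ Subtype.ext h'),
        fun h Q hQ => h (mapClosedPoint f Q)
          (fun h' => hQ (show f Q.1 = O.1 from congrArg Subtype.val h')) Q rfl⟩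
    have h2 : ∀ P ≠ O, E.valuation P (b ^ 2 * (algebraMap ℂ _ t' - x)) ≤ 1 ↔
        E.valuation P b ≤ 1 := by
      intro P hP
      have := hd P hP
      rcases eq_or_ne b 0 with rfl | hb
      · simp
      · rw [valuation_le_one_iff_ord hb, valuation_le_one_iff_ord
          (mul_ne_zero (pow_ne_zero 2 hb) hξ.d_ne_zero), ord_mul (pow_ne_zero 2 hb) hξ.d_ne_zero,
          ord_pow]
        push_cast
        omega
    have h3 : ∀ a : E.FunctionField, (∀ P ≠ O, E.valuation P a ≤ 1) ↔
        ∃ b, liftHom x y h b = a := by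
      intro a
      have h4 : (∀ P ≠ O, E.valuation P a ≤ 1) ↔
          ∀ P : closedPoints E.X, P.1 ∈ complement O → E.valuation P a ≤ 1 :=
        forall_congr' fun P => imp_congr_left (not_congr Subtype.ext_iff)
      rw [h4, ← exists_section_iff]
      constructor
      · rintro ⟨s, rfl⟩
        exact ⟨e.symm s, by rw [← he, e.apply_symm_apply]⟩
      · rintro ⟨b, rfl⟩
        exact ⟨e b, he b⟩
    rw [h1]
    constructor
    · intro hz
      obtain ⟨b₀, rfl⟩ := (h3 a).mp fun P hP =>
        ((forall_valuation_le_one_iff hf hE hξ).mp (hz P hP)).1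
      obtain ⟨b₁, rfl⟩ := (h3 b).mp fun P hP =>
        (h2 P hP).mp ((forall_valuation_le_one_iff hf hE hξ).mp (hz P hP)).2
      exact ⟨_, hlift b₀ b₁⟩
    · rintro ⟨r, hr⟩ P hP
      obtain ⟨b₀, b₁, rfl⟩ := exists_eq_biellipticCoverRingHom_add t t' r
      rw [hlift] at hr
      obtain ⟨rfl, rfl⟩ := hξ.eq_of_add_eq_add hr
      exact (forall_valuation_le_one_iff hf hE hξ).mpr
        ⟨(h3 _).mpr ⟨_, rfl⟩ P hP, (h2 P hP).mpr ((h3 _).mpr ⟨_, rfl⟩ P hP)⟩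

end

end NonsingularCurve

end

theorem mainTheorem7 (C E : NonsingularCurve) (hC : C.HasGenus 2) (hE : E.HasGenus 1)
    (f : C.X ⟶ E.X) (hf : f ≫ E.π = C.π) (hdeg : NonsingularCurve.HasDegree f 2) :
    ∃ t t' : ℂ, t ≠ 0 ∧ t ≠ 1 ∧ t' ≠ 0 ∧ t' ≠ 1 ∧ t ≠ t' ∧
      ∃ (i : DoubleCoverRing.curve (biellipticSextic t t') ⟶ C.X)
        (j : DoubleCoverRing.curve (legendreCubic t) ⟶ E.X),
        IsOpenImmersion i ∧ IsOpenImmersion j ∧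
        i ≫ C.π = DoubleCoverRing.toSpec (biellipticSextic t t') ∧
        j ≫ E.π = DoubleCoverRing.toSpec (legendreCubic t) ∧
        i ≫ f = biellipticCover t t' ≫ j := by
  open NonsingularCurve in
  have := hdeg.1
  have := isProper_of_comp_eq f hf
  -- `ℂ(C)` is generated over `ℂ(E)` by a square root of `d`, then of `d h²`
  obtain ⟨d, δ, hδ⟩ := IsSqrtGenerator.exists_of_finrank_eq_two _ (finrank_pullback f hdeg)
  obtain ⟨O, h, h0, hdO, hd, P, hP, hdP⟩ :=
    exists_normalized_mul_sq hE hδ.d_ne_zero (degree_halfDiv hf hδ hE hC)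
  obtain ⟨t, t', κ, x, y, ht0, ht1, ht0', ht1', htt', hκ, hxO, hx, hyO, hy, hyx, hdx⟩ :=
    exists_legendre hE hdO (fun P hP => (hd P hP).1) hdP
  have hκ' : algebraMap ℂ E.FunctionField κ ≠ 0 := (map_ne_zero _).mpr hκ
  -- the coordinate `ξ = δ h κ`, with `ξ² = t' - x`
  have hξ := (hδ.mul_map h0).mul_map hκ'
  have hd' : ∀ P, ord P (algebraMap ℂ _ t' - x) = ord P (d * h ^ 2) := by
    intro P
    rw [hdx, ord_mul (hδ.mul_map h0).d_ne_zero (pow_ne_zero 2 hκ'), ord_pow, ord_algebraMap]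
    ring
  rw [← hdx] at hξ
  have hyx' : y ^ 2 = Polynomial.aeval x (legendreCubic t) := by
    rw [hyx]
    simp [legendreCubic]
  have hU : Nonempty (complement O) := ⟨⟨_, genericPoint_mem_complement O⟩⟩
  have hV : Nonempty (f ⁻¹ᵁ complement O) := ⟨⟨_, genericPoint_mem_preimage_complement O⟩⟩
  obtain ⟨Q, hQ⟩ := mapClosedPoint_surjective f O
  have hUa : IsAffineOpen (complement O) := isAffineOpen_of_notMem hE (Q := O) fun h => h rfl
  have hVa : IsAffineOpen (f ⁻¹ᵁ complement O) :=
    isAffineOpen_of_notMem hC (Q := Q) fun h => h (congrArg Subtype.val hQ)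
  obtain ⟨eB, heB⟩ := exists_legendre_ringEquiv hE hyx' hxO hx hyO hy
  obtain ⟨eA, heA⟩ := exists_bielliptic_ringEquiv hf hE hyx' hxO hyO hξ
    (fun P hP => by rw [hd']; exact hd P hP) eB heB
  refine ⟨t, t', ht0, ht1, ht0', ht1', htt', affineModel hVa eA, affineModel hUa eB,
    inferInstance, inferInstance, affineModel_comp_π hVa eA fun c => ?_,
    affineModel_comp_π hUa eB fun c => ?_, ?_⟩
  · rw [heA]
    exact DoubleCoverRing.liftHom_algebraMap _ c
  · rw [heB]
    exact DoubleCoverRing.liftHom_algebraMap _ c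
  · refine affineModel_comp hUa hVa eB eA _ fun b => ?_
    rw [heA, heB, liftHom_biellipticCoverRingHom hf hyx' hξ]
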